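/- For integers $k\ge 1$ and $n\ge 7+12k$ let $R_{k,n}$ be the simplicial complex with vertex set $\mathbb Z/n$ whose triangles are all translates $[x,x+a,x+b]$, $x\in\mathbb Z/n$, of the following $2+4k$ generating triangles $[0,a,b]$: - $[0,2i-1,3k+2+i]$ and $[0,2i,3k+2+i]$ for $1\le i\le k$; - $[0,4k+3,6k+3]$ and $[0,2k+2,4k+3]$; - $[0,4k+3+i,6k+3-i]$ and $[0,4k+3+i,6k+4-i]$ for $1\le i\le k-1$; - $[0,2k+1,5k+3]$ and $[0,5k+3,5k+4]$. A triangulation of a (connected, closed) surface is understood as a finite connected simplicial complex in which the link of every vertex is a circle; it is orientable if its triangles can be oriented so that any two different triangles with a common edge induce opposite directions on that edge, and its Euler characteristic is $\chi=f_0-f_1+f_2$, where $f_i$ is its number of $i$-dimensional faces. **Corollary.** Let $k\ge 1$ and $n=8+12k$. Then $R_{k,n}$ is a vertex-minimal triangulation of the orientable closed surface of Euler characteristic $\chi=-2kn$, on $n$ vertices, with vertex-transitive cyclic symmetry. That is: $R_{k,n}$ is an orientable triangulation of a connected closed surface with Euler characteristic $-2kn$ (and its geometric realization is a compact connected Hausdorff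 space that is locally homeomorphic to $\mathbb R^2$); it has exactly $n$ vertices; every triangulation of the orientable connected closed surface of Euler characteristic $-2kn$ has at least $n$ vertices; equality holds in Heawood's bound, $n=\bigl\lceil\tfrac12\bigl(7+\sqrt{49-24\chi}\bigr)\bigr\rceil$; and some cyclic group of automorphisms of $R_{k,n}$ acts transitively on the vertices. -/

import Mathlib

namespace AbstractSimplicialComplex

variable {V : Type*}

/-- The `i`-th face number `f_i`: the number of faces of dimension `i`, i.e. with `i + 1` vertices. -/
noncomputable def faceNumber (K : AbstractSimplicialComplex V) (i : ℕ) : ℕ :=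
  {σ : Finset V | σ ∈ K.faces ∧ σ.card = i + 1}.ncard

/-- The Euler characteristic `f_0 - f_1 + f_2` of a complex of dimension at most two. -/
noncomputable def eulerChar (K : AbstractSimplicialComplex V) : ℤ :=
  (K.faceNumber 0 : ℤ) - (K.faceNumber 1 : ℤ) + (K.faceNumber 2 : ℤ)

/-- The link of the vertex `v`: the nonempty `σ` with `v ∉ σ` such that `σ ∪ {v}` is a face. -/
def linkFaces [DecidableEq V] (K : AbstractSimplicialComplex V) (v : V) : Set (Finset V) :=
  {σ | σ.Nonempty ∧ v ∉ σ ∧ insert v σ ∈ K.faces}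

/-- `L` is the set of faces of a triangulated circle `c 0, c 1, …, c (m - 1), c 0` of length
`m ≥ 3`: its nonempty faces are the vertices `c i` and the edges `{c i, c (i + 1)}`. -/
def IsCircle (L : Set (Finset V)) : Prop :=
  ∃ (m : ℕ) (c : ZMod m → V), 3 ≤ m ∧ Function.Injective c ∧
    ∀ σ : Finset V, σ ∈ L ↔
      σ.Nonempty ∧ ∃ i : ZMod m, (σ : Set V) ⊆ {c i, c (i + 1)}

/-- The 1-skeleton, as a graph. -/
def oneSkeleton [DecidableEq V] (K : AbstractSimplicialComplex V) : SimpleGraph V where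
  Adj u v := u ≠ v ∧ ({u, v} : Finset V) ∈ K.faces
  symm := ⟨fun u v h => ⟨h.1.symm, by rw [Finset.pair_comm]; exact h.2⟩⟩
  loopless := ⟨fun _ h => h.1 rfl⟩

/-- A simplicial complex (on a finite vertex set) is a triangulated connected closed surface when
it is connected and the link of every vertex is a circle. -/
structure IsTriangulatedSurface [DecidableEq V] (K : AbstractSimplicialComplex V) : Prop where
  connected : K.oneSkeleton.Connected
  link_isCircle : ∀ v : V, IsCircle (K.linkFaces v)

/-- Orientability: the triangles can be oriented so that any two different triangles with a common
edge induce opposite directions on it. Here `O a b c` says that `{a, b, c}` is a triangle whose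
chosen orientation is the cyclic order `a → b → c → a`. -/
def IsOrientable [DecidableEq V] (K : AbstractSimplicialComplex V) : Prop :=
  ∃ O : V → V → V → Prop,
    (∀ a b c, O a b c → a ≠ b ∧ b ≠ c ∧ a ≠ c ∧ ({a, b, c} : Finset V) ∈ K.faces) ∧
    (∀ a b c, O a b c → O b c a) ∧
    (∀ a b c, a ≠ b → b ≠ c → a ≠ c → ({a, b, c} : Finset V) ∈ K.faces →
      (O a b c ↔ ¬ O b a c)) ∧
    (∀ a b c d, O a b c → O a b d → c = d)

/-- `K` triangulates the orientable (connected, closed) surface of Euler characteristic `χ`. -/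
structure TriangulatesOrientableSurface [DecidableEq V] (K : AbstractSimplicialComplex V)
    (χ : ℤ) : Prop where
  isTriangulatedSurface : K.IsTriangulatedSurface
  isOrientable : K.IsOrientable
  eulerChar_eq : K.eulerChar = χ

/-- The geometric realization of a finite simplicial complex, in barycentric coordinates. -/
def realization [Fintype V] (K : AbstractSimplicialComplex V) : Set (V → ℝ) :=
  {w | w ∈ stdSimplex ℝ V ∧ ∃ σ ∈ K.faces, ∀ v, v ∉ σ → w v = 0}

/-- The group of automorphisms: the permutations of the vertices that map faces to faces (and
nonfaces to nonfaces). -/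
def autGroup (K : AbstractSimplicialComplex V) : Subgroup (Equiv.Perm V) where
  carrier := {φ | ∀ σ : Finset V, σ.map φ.toEmbedding ∈ K.faces ↔ σ ∈ K.faces}
  one_mem' := fun σ => by
    have h : σ.map (1 : Equiv.Perm V).toEmbedding = σ := Finset.map_refl
    rw [h]
  mul_mem' := fun {φ ψ} hφ hψ σ => by
    have h : σ.map (φ * ψ).toEmbedding = (σ.map ψ.toEmbedding).map φ.toEmbedding := by
      rw [Finset.map_map]; rfl
    rw [h, hφ, hψ]
  inv_mem' := fun {φ} hφ σ => by
    have h : (σ.map (φ⁻¹).toEmbedding).map φ.toEmbedding = σ := by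
      rw [Finset.map_map]
      convert Finset.map_refl using 2
      ext x
      simp
    rw [← hφ, h]

/-- Vertex-transitive cyclic symmetry: some cyclic group of automorphisms acts transitively on the
vertices. -/
def HasVertexTransitiveCyclicSymmetry (K : AbstractSimplicialComplex V) : Prop :=
  ∃ C : Subgroup (Equiv.Perm V), C ≤ K.autGroup ∧ IsCyclic C ∧ MulAction.IsPretransitive C V

end AbstractSimplicialComplex

/-- A connected closed surface: a compact connected Hausdorff space in which every point has an
open neighbourhood homeomorphic to the plane. -/
structure IsConnectedClosedSurface (X : Type*) [TopologicalSpace X] : Prop where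
  compact : CompactSpace X
  hausdorff : T2Space X
  connected : ConnectedSpace X
  locally_euclidean : ∀ x : X, ∃ U : TopologicalSpace.Opens X,
    x ∈ U ∧ Nonempty (U ≃ₜ EuclideanSpace ℝ (Fin 2))

/-- The `2 + 4 k` generating triangles of the generalized Ringel series, for `k ≥ 1`: the pair
`(a, b)` stands for the triangle `[0, a, b]`. -/
def ringelGenerators (k : ℕ) : Set (ℕ × ℕ) :=
  {p | ∃ i < k, p = (2 * i + 1, 3 * k + 3 + i) ∨ p = (2 * i + 2, 3 * k + 3 + i)} ∪
  {(4 * k + 3, 6 * k + 3), (2 * k + 2, 4 * k + 3)} ∪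
  {p | ∃ i < k - 1, p = (4 * k + 4 + i, 6 * k + 2 - i) ∨ p = (4 * k + 4 + i, 6 * k + 3 - i)} ∪
  {(2 * k + 1, 5 * k + 3), (5 * k + 3, 5 * k + 4)}

/-- The complex `R_{k,n}` (for `k ≥ 1` and `n ≥ 7 + 12 k`): its vertices are the elements of
`ℤ/n`, its triangles are the translates of the generating triangles, and its faces are the nonempty
subsets of the triangles. -/
def ringelComplex (k n : ℕ) : AbstractSimplicialComplex (ZMod n) where
  faces := {σ | σ.Nonempty ∧ ∃ x : ZMod n, ∃ p ∈ ringelGenerators k,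
    (σ : Set (ZMod n)) ⊆ {x, x + (p.1 : ZMod n), x + (p.2 : ZMod n)}}
  isRelLowerSet_faces := fun _ hσ => ⟨hσ.1, fun _ hτσ hτ => ⟨hτ, by
    obtain ⟨_, x, p, hp, h⟩ := hσ
    exact ⟨x, p, hp, (Finset.coe_subset.mpr hτσ).trans h⟩⟩⟩
  singleton_mem := fun v => ⟨Finset.singleton_nonempty v, v, (2 * k + 1, 5 * k + 3),
    Or.inr (Or.inl rfl), by simp⟩

/-! Put n = 12k + 8. The complex is invariant under translations, so everything about its local
structure is read off at the vertex 0. There the 4k + 2 generating triangles, each translated so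
that any of its three corners comes to 0, give 12k + 6 edges, and these form one closed cycle. It
passes once through every residue except 0 and n/2. `ringelLink` writes this cycle down explicitly
by integer representatives. `exists_ringelLink_of_ringelOriented` and `ringelStep_ringelLink` show
that its steps are exactly the edges coming from generators.

The generators are listed in `RingelOriented` with a suitable order of their corners, so that the
cycle is even traversed consistently. A directed edge then lies in exactly one positively oriented
triangle, which yields orientability as well as circular links. Since every vertex has degree n - 2,
counting gives f₁ = n(n-2)/2, f₂ = n(n-2)/3 and χ = n(8-n)/6 = -2kn.

Minimality is Heawood's inequality: 3f₂ = 2f₁ and f₁ ≤ f₀(f₀-1)/2 hold in every triangulated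
surface, and for this χ they rule out f₀ < n.

That the realization is a topological surface holds for any complex with circular links. The open
star of a vertex is a cone over a circle, which projects radially to a complete planar fan
(`nonempty_openStar_homeomorph`), and the open stars cover the realization. -/

namespace AbstractSimplicialComplex

/-! ### Face counts of triangulated surfaces and Heawood's inequality -/

section Counting

theorem ZMod_two_ne_zero {m : ℕ} (hm : 3 ≤ m) : (2 : ZMod m) ≠ 0 := by
  intro h
  have h2 : ((2 : ℕ) : ZMod m) = 0 := by exact_mod_cast h
  rw [ZMod.natCast_eq_zero_iff] at h2
  exact absurd (Nat.le_of_dvd (by norm_num) h2) (by omega)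

theorem ZMod_add_one_ne {m : ℕ} (hm : 3 ≤ m) (i : ZMod m) : i + 1 ≠ i := by
  intro h
  have h1 : (1 : ZMod m) = 0 := by simpa using h
  apply ZMod_two_ne_zero hm
  linear_combination 2 * h1

variable {V : Type*}

/-- A circle of length `m` has `m` vertices. -/
theorem ncard_circle_vertices {m : ℕ} {c : ZMod m → V} {L : Set (Finset V)}
    (hc : Function.Injective c)
    (hL : ∀ σ : Finset V, σ ∈ L ↔
      σ.Nonempty ∧ ∃ i : ZMod m, (σ : Set V) ⊆ {c i, c (i + 1)}) :
    {σ | σ ∈ L ∧ σ.card = 1}.ncard = m := by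
  have h : {σ | σ ∈ L ∧ σ.card = 1} = (fun i => ({c i} : Finset V)) '' Set.univ := by
    ext σ
    simp only [Set.mem_ofPred_eq, Set.image_univ, Set.mem_range, hL]
    constructor
    · rintro ⟨⟨-, i, hi⟩, h1⟩
      obtain ⟨a, rfl⟩ := Finset.card_eq_one.mp h1
      have ha : a = c i ∨ a = c (i + 1) := by simpa using hi
      rcases ha with rfl | rfl
      exacts [⟨_, rfl⟩, ⟨_, rfl⟩]
    · rintro ⟨i, rfl⟩
      exact ⟨⟨by simp, i, by simp⟩, by simp⟩
  rw [h, Set.ncard_image_of_injective _ (fun i j hij => hc (by simpa using hij)), Set.ncard_univ,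
    Nat.card_zmod]

/-- A circle of length `m` has `m` edges. -/
theorem ncard_circle_edges [DecidableEq V] {m : ℕ} {c : ZMod m → V} {L : Set (Finset V)}
    (hm : 3 ≤ m) (hc : Function.Injective c)
    (hL : ∀ σ : Finset V, σ ∈ L ↔
      σ.Nonempty ∧ ∃ i : ZMod m, (σ : Set V) ⊆ {c i, c (i + 1)}) :
    {σ | σ ∈ L ∧ σ.card = 2}.ncard = m := by
  have hne : ∀ i, c i ≠ c (i + 1) := fun i h => ZMod_add_one_ne hm i (hc h).symm
  have h : {σ | σ ∈ L ∧ σ.card = 2} = (fun i => ({c i, c (i + 1)} : Finset V)) '' Set.univ := by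
    ext σ
    simp only [Set.mem_ofPred_eq, Set.image_univ, Set.mem_range, hL]
    constructor
    · rintro ⟨⟨-, i, hi⟩, h1⟩
      refine ⟨i, (Finset.eq_of_subset_of_card_le (t := {c i, c (i + 1)}) ?_ ?_).symm⟩
      · intro x hx
        simpa using hi hx
      · rw [h1]
        exact Finset.card_le_two
    · rintro ⟨i, rfl⟩
      exact ⟨⟨by simp, i, by simp⟩, Finset.card_pair (hne i)⟩
  rw [h, Set.ncard_image_of_injective, Set.ncard_univ, Nat.card_zmod]
  intro i j hij
  have hi : c i ∈ ({c j, c (j + 1)} : Finset V) := by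
    rw [← show ({c i, c (i + 1)} : Finset V) = {c j, c (j + 1)} from hij]; simp
  have hj : c (i + 1) ∈ ({c j, c (j + 1)} : Finset V) := by
    rw [← show ({c i, c (i + 1)} : Finset V) = {c j, c (j + 1)} from hij]; simp
  simp only [Finset.mem_insert, Finset.mem_singleton, hc.eq_iff] at hi hj
  rcases hi with hi | hi
  · exact hi
  rcases hj with hj | hj
  · exfalso
    apply ZMod_two_ne_zero hm
    rw [hi] at hj
    linear_combination hj
  · exact add_right_cancel hj

/-- Counting the pairs of a vertex `v` and a face of dimension `j` that contains it. -/
theorem sum_ncard_linkFaces [Fintype V] [DecidableEq V] (K : AbstractSimplicialComplex V)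
    {j : ℕ} (hj : j ≠ 0) :
    ∑ v, {σ | σ ∈ K.linkFaces v ∧ σ.card = j}.ncard = (j + 1) * K.faceNumber j := by
  classical
  set A : Finset (Finset V) := Finset.univ.filter fun σ => σ ∈ K.faces ∧ σ.card = j + 1 with hA
  have hf : K.faceNumber j = A.card := by
    rw [faceNumber, ← Set.ncard_coe_finset]
    congr 1
    ext σ
    simp [hA]
  have hlink : ∀ v, {σ | σ ∈ K.linkFaces v ∧ σ.card = j}.ncard =
      (A.filter fun σ => v ∈ σ).card := by
    intro v
    rw [← Set.ncard_coe_finset]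
    refine Set.ncard_congr (fun σ _ => insert v σ) ?_ ?_ ?_
    · rintro σ ⟨⟨-, hv, hσ⟩, hc⟩
      simp [hA, hσ, Finset.card_insert_of_notMem hv, hc]
    · rintro σ τ ⟨⟨-, hv, -⟩, -⟩ ⟨⟨-, hv', -⟩, -⟩ h
      rw [← Finset.erase_insert hv, ← Finset.erase_insert hv', h]
    · intro σ hσ
      simp only [hA, Finset.coe_filter, Finset.mem_filter, Finset.mem_univ, true_and,
        Set.mem_ofPred_eq] at hσ
      obtain ⟨⟨hσ, hc⟩, hv⟩ := hσ
      have hcard : (σ.erase v).card = j := by rw [Finset.card_erase_of_mem hv, hc]; rfl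
      refine ⟨σ.erase v, ⟨⟨?_, Finset.notMem_erase v σ, ?_⟩, hcard⟩, Finset.insert_erase hv⟩
      · rw [← Finset.card_pos]; omega
      · rwa [Finset.insert_erase hv]
  simp only [hlink, hf]
  have := Finset.sum_card_bipartiteAbove_eq_sum_card_bipartiteBelow
    (s := (Finset.univ : Finset V)) (t := A) (fun v σ => v ∈ σ)
  simp only [Finset.bipartiteAbove, Finset.bipartiteBelow] at this
  rw [this, mul_comm, ← smul_eq_mul]
  refine Finset.sum_const_nat ?_
  intro σ hσ
  rw [Finset.filter_univ_mem]
  exact (Finset.mem_filter.mp hσ).2.2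

theorem faceNumber_zero [Fintype V] (K : AbstractSimplicialComplex V) :
    K.faceNumber 0 = Fintype.card V := by
  have h : {σ : Finset V | σ ∈ K.faces ∧ σ.card = 0 + 1} =
      (fun v => ({v} : Finset V)) '' Set.univ := by
    ext σ
    simp only [Set.mem_ofPred_eq, zero_add, Finset.card_eq_one, Set.image_univ, Set.mem_range]
    constructor
    · rintro ⟨-, a, rfl⟩
      exact ⟨a, rfl⟩
    · rintro ⟨a, rfl⟩
      exact ⟨K.singleton_mem a, a, rfl⟩
  rw [faceNumber, h, Set.ncard_image_of_injective _ Finset.singleton_injective, Set.ncard_univ,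
    Nat.card_eq_fintype_card]

/-- In a triangulated surface, `2 f₁ = 3 f₂`. -/
theorem IsTriangulatedSurface.two_mul_faceNumber_one [Fintype V] [DecidableEq V]
    {K : AbstractSimplicialComplex V}
    (hK : K.IsTriangulatedSurface) : 2 * K.faceNumber 1 = 3 * K.faceNumber 2 := by
  have h1 := K.sum_ncard_linkFaces one_ne_zero
  have h2 := K.sum_ncard_linkFaces two_ne_zero
  rw [← one_add_one_eq_two, ← h1, show (3 : ℕ) = 2 + 1 from rfl, one_add_one_eq_two, ← h2]
  -- The two sums agree term by term, because a circle has as many vertices as edges.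
  refine Finset.sum_congr rfl fun v _ => ?_
  obtain ⟨m, c, hm, hc, hL⟩ := hK.link_isCircle v
  rw [ncard_circle_vertices hc hL, ncard_circle_edges hm hc hL]

/-- A vertex does not lie in its own link, so each link has at most `Fintype.card V - 1` vertices;
summing over all vertices counts every edge twice. -/
theorem two_mul_faceNumber_one_le [Fintype V] [DecidableEq V] (K : AbstractSimplicialComplex V) :
    2 * K.faceNumber 1 ≤ Fintype.card V * (Fintype.card V - 1) := by
  rw [show (2 : ℕ) = 1 + 1 from rfl, ← K.sum_ncard_linkFaces one_ne_zero, ← smul_eq_mul,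
    ← Finset.card_univ]
  refine Finset.sum_le_card_nsmul _ _ _ fun v _ => ?_
  rw [← Finset.card_erase_of_mem (Finset.mem_univ v), ← Set.ncard_coe_finset,
    ← Set.ncard_image_of_injective ((Finset.univ.erase v : Finset V) : Set V)
      (Finset.singleton_injective (α := V))]
  refine Set.ncard_le_ncard ?_ (Set.toFinite _)
  rintro σ ⟨⟨-, hv, -⟩, h1⟩
  obtain ⟨a, rfl⟩ := Finset.card_eq_one.mp h1
  exact ⟨a, by simpa using fun h => hv (by simp [h]), rfl⟩

/-- Heawood's inequality. -/
theorem IsTriangulatedSurface.heawood [Fintype V] [DecidableEq V]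
    {K : AbstractSimplicialComplex V}
    (hK : K.IsTriangulatedSurface) :
    7 * (K.faceNumber 0 : ℤ) - (K.faceNumber 0 : ℤ) ^ 2 ≤ 6 * K.eulerChar := by
  have h1 := hK.two_mul_faceNumber_one
  have h2 := K.two_mul_faceNumber_one_le
  rw [← K.faceNumber_zero] at h2
  have h3 : 2 * (K.faceNumber 1 : ℤ) ≤ (K.faceNumber 0 : ℤ) * ((K.faceNumber 0 : ℤ) - 1) := by
    -- The truncated subtraction in `h2` agrees with the integer one only when there is a vertex.
    rcases Nat.eq_zero_or_pos (K.faceNumber 0) with h | h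
    · rw [h] at h2 ⊢
      push_cast
      omega
    · zify [h] at h2
      exact h2
  rw [eulerChar]
  -- With 3f₂ = 2f₁ one gets 6χ = 6f₀ - 2f₁, and `h3` bounds 2f₁.
  zify at h1
  nlinarith

end Counting

/-! ### The plane as a complete fan with m rays -/

section Fan

open scoped Real

/-- The hat function on the unit circle that is `1` at `j / m` and vanishes outside the two adjacent
arcs of length `1 / m`. -/
noncomputable def circleHat {m : ℕ} [NeZero m] (j : ZMod m) (θ : UnitAddCircle) : ℝ :=
  max 0 (1 - m * ‖θ - ZMod.toAddCircle j‖)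

theorem circleHat_nonneg {m : ℕ} [NeZero m] (j : ZMod m) (θ : UnitAddCircle) :
    0 ≤ circleHat j θ := le_max_left _ _

theorem circleHat_le_one {m : ℕ} [NeZero m] (j : ZMod m) (θ : UnitAddCircle) :
    circleHat j θ ≤ 1 := by
  refine max_le zero_le_one ?_
  have : 0 ≤ (m : ℝ) * ‖θ - ZMod.toAddCircle j‖ := by positivity
  linarith

theorem continuous_circleHat {m : ℕ} [NeZero m] (j : ZMod m) :
    Continuous (circleHat j : UnitAddCircle → ℝ) := by
  unfold circleHat
  fun_prop

/-- The point of the unit circle that lies at the fraction `t` of the way from `i / m` to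
`(i + 1) / m`. -/
noncomputable def arcPoint {m : ℕ} [NeZero m] (i : ZMod m) (t : ℝ) : UnitAddCircle :=
  ZMod.toAddCircle i + ((t / m : ℝ) : UnitAddCircle)

theorem exists_arcPoint (m : ℕ) [NeZero m] (θ : UnitAddCircle) :
    ∃ (i : ZMod m) (t : ℝ), 0 ≤ t ∧ t < 1 ∧ θ = arcPoint i t := by
  obtain ⟨x, rfl⟩ := QuotientAddGroup.mk_surjective θ
  have hm : (m : ℝ) ≠ 0 := Nat.cast_ne_zero.mpr (NeZero.ne m)
  refine ⟨(⌊x * m⌋ : ℤ), Int.fract (x * m), Int.fract_nonneg _, Int.fract_lt_one _, ?_⟩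
  rw [arcPoint, ZMod.toAddCircle_intCast, ← AddCircle.coe_add, ← add_div, Int.floor_add_fract,
    mul_div_cancel_right₀ _ hm]

theorem circleHat_arcPoint_sub {m : ℕ} [NeZero m] (i j : ZMod m) (t : ℝ) :
    circleHat j (arcPoint i t) = circleHat (j - i) (arcPoint (0 : ZMod m) t) := by
  simp only [circleHat, arcPoint, map_sub, map_zero]
  congr 4
  abel

theorem norm_coe_unitAddCircle_eq {x : ℝ} (hx : |x| ≤ 1 / 2) : ‖(x : UnitAddCircle)‖ = |x| := by
  rw [AddCircle.norm_coe_eq_abs_iff _ one_ne_zero]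
  simpa using hx

theorem circleHat_arcPoint_left {m : ℕ} [NeZero m] (hm : 3 ≤ m) (i : ZMod m) {t : ℝ} (h0 : 0 ≤ t)
    (h1 : t ≤ 1) : circleHat i (arcPoint i t) = 1 - t := by
  have hm' : (3 : ℝ) ≤ m := by exact_mod_cast hm
  have h : |t / m| ≤ 1 / 2 := by
    rw [abs_of_nonneg (by positivity), div_le_iff₀ (by positivity)]
    linarith
  rw [circleHat, arcPoint, add_sub_cancel_left, norm_coe_unitAddCircle_eq h,
    abs_of_nonneg (by positivity), mul_div_cancel₀ _ (by positivity), max_eq_right (by linarith)]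

theorem circleHat_arcPoint_right {m : ℕ} [NeZero m] (hm : 3 ≤ m) (i : ZMod m) {t : ℝ} (h0 : 0 ≤ t)
    (h1 : t ≤ 1) : circleHat (i + 1) (arcPoint i t) = t := by
  have hm' : (3 : ℝ) ≤ m := by exact_mod_cast hm
  have e : |(t - 1) / m| = (1 - t) / m := by
    rw [abs_div, abs_of_nonneg (by positivity : (0 : ℝ) ≤ m), abs_of_nonpos (by linarith)]
    ring
  have h : |(t - 1) / m| ≤ 1 / 2 := by
    rw [e, div_le_iff₀ (by positivity)]
    linarith
  have hp : arcPoint i t - ZMod.toAddCircle (i + 1) = (((t - 1) / m : ℝ) : UnitAddCircle) := by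
    have h1 : ZMod.toAddCircle (1 : ZMod m) = ((1 / m : ℝ) : UnitAddCircle) := by
      simpa using ZMod.toAddCircle_natCast (N := m) 1
    rw [arcPoint, map_add, add_sub_add_left_eq_sub, h1, ← AddCircle.coe_sub, ← sub_div]
  rw [circleHat, hp, norm_coe_unitAddCircle_eq h, e, mul_div_cancel₀ _ (by positivity),
    max_eq_right (by linarith)]
  ring

/-- After a rotation, i = 0 and j is the class of some a with 2 ≤ a ≤ m - 1. Then (t - a)/m lies
between -1 + 1/m and -1/m, hence at distance at least 1/m from every integer. -/
theorem circleHat_arcPoint_of_ne {m : ℕ} [NeZero m] {i j : ZMod m} {t : ℝ} (h0 : 0 ≤ t)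
    (h1 : t ≤ 1) (hi : j ≠ i) (hi' : j ≠ i + 1) : circleHat j (arcPoint i t) = 0 := by
  rw [circleHat_arcPoint_sub]
  have hm0 : (0 : ℝ) < m := Nat.cast_pos.mpr (NeZero.pos m)
  obtain ⟨a, ha, haj⟩ : ∃ a : ℕ, a < m ∧ (a : ZMod m) = j - i :=
    ⟨(j - i).val, ZMod.val_lt _, ZMod.natCast_zmod_val _⟩
  have ha2 : 2 ≤ a := by
    by_contra! h
    interval_cases a
    · exact hi (sub_eq_zero.mp (by simpa using haj.symm))
    · apply hi'
      rw [Nat.cast_one] at haj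
      rw [haj]; ring
  have ha2' : (2 : ℝ) ≤ a := by exact_mod_cast ha2
  have ham : (a : ℝ) + 1 ≤ m := by exact_mod_cast ha
  rw [← haj, circleHat, arcPoint, map_zero, zero_add, ZMod.toAddCircle_natCast, ← AddCircle.coe_sub,
    ← sub_div, UnitAddCircle.norm_eq]
  refine max_eq_left ?_
  suffices h : 1 / (m : ℝ) ≤ |(t - a) / m - round ((t - a) / m)| by
    have := mul_le_mul_of_nonneg_left h hm0.le
    rw [mul_one_div_cancel hm0.ne'] at this
    linarith
  have hx1 : (t - a) / m ≤ -(1 / m) := by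
    rw [← neg_div, div_le_div_iff_of_pos_right hm0]; linarith
  have hx2 : -1 + 1 / m ≤ (t - a) / m := by
    rw [le_div_iff₀ hm0, add_mul, one_div_mul_cancel hm0.ne']; linarith
  generalize round ((t - a) / m) = r
  rcases le_or_gt 0 r with hr | hr
  · have : (0 : ℝ) ≤ r := by exact_mod_cast hr
    refine le_abs.mpr (Or.inr ?_)
    linarith
  · have : (r : ℝ) ≤ -1 := by exact_mod_cast Int.le_sub_one_of_lt hr
    refine le_abs.mpr (Or.inl ?_)
    linarith

theorem sum_eq_of_support_pair {m : ℕ} [NeZero m] (hm : 3 ≤ m) {i : ZMod m} {y : ZMod m → ℝ}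
    (hy : ∀ j, j ≠ i → j ≠ i + 1 → y j = 0) : ∑ j, y j = y i + y (i + 1) :=
  Finset.sum_eq_add i (i + 1) (ZMod_add_one_ne hm i).symm (fun j _ hj => hy j hj.1 hj.2)
    (by simp) (by simp)

theorem sum_circleHat {m : ℕ} [NeZero m] (hm : 3 ≤ m) (θ : UnitAddCircle) :
    ∑ j : ZMod m, circleHat j θ = 1 := by
  obtain ⟨i, t, h0, h1, rfl⟩ := exists_arcPoint m θ
  rw [sum_eq_of_support_pair hm fun j => circleHat_arcPoint_of_ne h0 h1.le,
    circleHat_arcPoint_left hm i h0 h1.le, circleHat_arcPoint_right hm i h0 h1.le]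
  ring

/-- Choosing t < 1 makes the hat at the left end of the arc strictly positive. Two points with equal
hats therefore have left ends that are equal or adjacent, and adjacency is excluded by applying the
same remark to the other point. -/
theorem circleHat_injective {m : ℕ} [NeZero m] (hm : 3 ≤ m) :
    Function.Injective fun (θ : UnitAddCircle) (j : ZMod m) => circleHat j θ := by
  intro θ θ' h
  obtain ⟨i, t, h0, h1, rfl⟩ := exists_arcPoint m θ
  obtain ⟨i', t', h0', h1', rfl⟩ := exists_arcPoint m θ'
  have hj : ∀ j, circleHat j (arcPoint i t) = circleHat j (arcPoint i' t') := congrFun h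
  have hl := hj i
  rw [circleHat_arcPoint_left hm i h0 h1.le] at hl
  by_cases hi : i = i'
  · subst hi
    rw [circleHat_arcPoint_left hm i h0' h1'.le] at hl
    rw [show t = t' by linarith]
  · exfalso
    have hi2 : i = i' + 1 := by
      by_contra hi2
      rw [circleHat_arcPoint_of_ne h0' h1'.le hi hi2] at hl
      linarith
    have hr := hj i'
    rw [circleHat_arcPoint_left hm i' h0' h1'.le, circleHat_arcPoint_of_ne h0 h1.le (Ne.symm hi)]
      at hr
    · linarith
    · intro h
      apply ZMod_two_ne_zero hm
      linear_combination -h - hi2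

/-- The argument of a complex number, as a point of the unit circle. -/
noncomputable def unitArg (z : ℂ) : UnitAddCircle :=
  AddCircle.homeomorphAddCircle (2 * π) 1 Real.two_pi_pos.ne' one_ne_zero (z.arg : Real.Angle)

theorem continuousAt_unitArg {z : ℂ} (hz : z ≠ 0) : ContinuousAt unitArg z :=
  (Homeomorph.continuous _).continuousAt.comp (Complex.continuousAt_arg_coe_angle hz)

theorem eq_of_norm_eq_of_unitArg_eq {z w : ℂ} (h : ‖z‖ = ‖w‖) (h' : unitArg z = unitArg w) :
    z = w :=
  Complex.ext_norm_arg h (Complex.arg_coe_angle_eq_iff.mp ((Homeomorph.injective _) h'))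

theorem exists_norm_eq_unitArg_eq {r : ℝ} (hr : 0 < r) (θ : UnitAddCircle) :
    ∃ z : ℂ, ‖z‖ = r ∧ unitArg z = θ := by
  obtain ⟨α, rfl⟩ := (AddCircle.homeomorphAddCircle (2 * π) 1 Real.two_pi_pos.ne'
    one_ne_zero).surjective θ
  obtain ⟨x, rfl⟩ := QuotientAddGroup.mk_surjective α
  refine ⟨r * (Real.cos x + Real.sin x * Complex.I), ?_, ?_⟩
  · rw [norm_mul, Complex.ofReal_cos, Complex.ofReal_sin, Complex.norm_cos_add_sin_mul_I, mul_one,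
      Complex.norm_real, Real.norm_of_nonneg hr.le]
  · have := Complex.arg_mul_cos_add_sin_mul_I_coe_angle hr (x : Real.Angle)
    rw [Real.Angle.cos_coe, Real.Angle.sin_coe] at this
    rw [unitArg, this]
    rfl

/-- The homeomorphism of the plane onto the complete simplicial fan with `m` rays, as a map to the
space of coordinates along the rays. -/
noncomputable def fanCoord {m : ℕ} [NeZero m] (z : ℂ) (j : ZMod m) : ℝ :=
  ‖z‖ * circleHat j (unitArg z)

/-- As a map to the circle the argument is continuous away from 0; at 0 the bounded hats are damped
by the factor ‖z‖. -/
theorem continuous_fanCoord {m : ℕ} [NeZero m] :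
    Continuous (fanCoord : ℂ → ZMod m → ℝ) := by
  refine continuous_pi fun j => continuous_iff_continuousAt.mpr fun z => ?_
  by_cases hz : z = 0
  · subst hz
    have h0 : (fanCoord (0 : ℂ) : ZMod m → ℝ) j = 0 := by simp [fanCoord]
    rw [ContinuousAt, h0]
    refine squeeze_zero (fun z => mul_nonneg (norm_nonneg z) (circleHat_nonneg _ _))
      (fun z => mul_le_of_le_one_right (norm_nonneg z) (circleHat_le_one _ _)) ?_
    simpa using (continuous_norm (E := ℂ)).tendsto 0
  · exact continuous_norm.continuousAt.mul
      ((continuous_circleHat j).continuousAt.comp (continuousAt_unitArg hz))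

theorem sum_fanCoord {m : ℕ} [NeZero m] (hm : 3 ≤ m) (z : ℂ) :
    ∑ j : ZMod m, fanCoord z j = ‖z‖ := by
  simp only [fanCoord]
  rw [← Finset.mul_sum, sum_circleHat hm, mul_one]

theorem fanCoord_injective {m : ℕ} [NeZero m] (hm : 3 ≤ m) :
    Function.Injective (fanCoord : ℂ → ZMod m → ℝ) := by
  intro z w h
  have hn : ‖z‖ = ‖w‖ := by rw [← sum_fanCoord hm, ← sum_fanCoord hm, h]
  by_cases hz : ‖z‖ = 0
  · rw [norm_eq_zero.mp hz, norm_eq_zero.mp (hn.symm.trans hz)]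
  · refine eq_of_norm_eq_of_unitArg_eq hn (circleHat_injective hm (funext fun j => ?_))
    have := congrFun h j
    simp only [fanCoord, ← hn] at this
    exact mul_left_cancel₀ hz this

/-- The m coordinates add up to ‖z‖, so the sup norm of the image is at least ‖z‖/m. The map is thus
proper, hence closed. -/
theorem isClosedEmbedding_fanCoord {m : ℕ} [NeZero m] (hm : 3 ≤ m) :
    Topology.IsClosedEmbedding (fanCoord : ℂ → ZMod m → ℝ) := by
  refine .of_continuous_injective_isClosedMap continuous_fanCoord (fanCoord_injective hm) ?_
  refine (isProperMap_iff_tendsto_cocompact.mpr ⟨continuous_fanCoord, ?_⟩).isClosedMap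
  rw [← Metric.cobounded_eq_cocompact (α := ZMod m → ℝ), ← tendsto_norm_atTop_iff_cobounded]
  have h : Filter.Tendsto (fun z : ℂ => (m : ℝ)⁻¹ * ‖z‖) (Filter.cocompact ℂ) Filter.atTop :=
    (tendsto_norm_cocompact_atTop (E := ℂ)).const_mul_atTop
      (inv_pos.mpr (Nat.cast_pos.mpr (NeZero.pos m)))
  refine Filter.tendsto_atTop_mono (fun z => ?_) h
  rw [inv_mul_le_iff₀ (Nat.cast_pos.mpr (NeZero.pos m)), ← sum_fanCoord hm z]
  refine (Finset.sum_le_card_nsmul _ _ ‖(fanCoord z : ZMod m → ℝ)‖ fun j _ => ?_).trans ?_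
  · exact (le_abs_self _).trans (norm_le_pi_norm (fanCoord z) j)
  · simp [ZMod.card]

theorem fanCoord_nonneg {m : ℕ} [NeZero m] (z : ℂ) (j : ZMod m) : 0 ≤ fanCoord z j :=
  mul_nonneg (norm_nonneg z) (circleHat_nonneg _ _)

theorem exists_fanCoord_support (m : ℕ) [NeZero m] (z : ℂ) :
    ∃ i : ZMod m, ∀ j, j ≠ i → j ≠ i + 1 → fanCoord z j = 0 := by
  obtain ⟨i, t, h0, h1, h⟩ := exists_arcPoint m (unitArg z)
  refine ⟨i, fun j hj hj' => ?_⟩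
  rw [fanCoord, h, circleHat_arcPoint_of_ne h0 h1.le hj hj', mul_zero]

/-- The preimage has modulus `y i + y (i + 1)`, and its angle divides the i-th arc in the proportion
of these two coordinates. If both vanish, the angle is undefined and the preimage is 0. -/
theorem exists_fanCoord_eq {m : ℕ} [NeZero m] (hm : 3 ≤ m) {y : ZMod m → ℝ} (hy : ∀ j, 0 ≤ y j)
    {i : ZMod m} (hi : ∀ j, j ≠ i → j ≠ i + 1 → y j = 0) : ∃ z : ℂ, fanCoord z = y := by
  rcases (add_nonneg (hy i) (hy (i + 1))).eq_or_lt with hs | hs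
  · refine ⟨0, funext fun j => ?_⟩
    have h1 := hy i
    have h2 := hy (i + 1)
    rw [fanCoord, norm_zero, zero_mul]
    by_cases hj : j = i
    · subst hj; linarith
    by_cases hj' : j = i + 1
    · subst hj'; linarith
    · exact (hi j hj hj').symm
  · obtain ⟨z, hz, hθ⟩ := exists_norm_eq_unitArg_eq hs (arcPoint i (y (i + 1) / (y i + y (i + 1))))
    have h0 : 0 ≤ y (i + 1) / (y i + y (i + 1)) := div_nonneg (hy _) hs.le
    have h1 : y (i + 1) / (y i + y (i + 1)) ≤ 1 := by
      rw [div_le_one hs]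
      linarith [hy i]
    refine ⟨z, funext fun j => ?_⟩
    rw [fanCoord, hz, hθ]
    by_cases hj : j = i
    · subst hj
      rw [circleHat_arcPoint_left hm j h0 h1]
      field_simp
      ring
    by_cases hj' : j = i + 1
    · subst hj'
      rw [circleHat_arcPoint_right hm i h0 h1]
      field_simp
    · rw [circleHat_arcPoint_of_ne h0 h1 hj hj', hi j hj hj', mul_zero]

end Fan

/-! ### Coordinates on the open star of a vertex -/

section StarPoint

variable {V : Type*} [DecidableEq V] {m : ℕ} [NeZero m]

/-- The point of the open star of `v` with coordinates `y` relative to the vertices `c i` of the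
link. -/
noncomputable def starPoint (v : V) (c : ZMod m → V) (y : ZMod m → ℝ) (u : V) : ℝ :=
  ((if u = v then 1 else 0) + ∑ i, if u = c i then y i else 0) / (1 + ∑ i, y i)

theorem continuousOn_starPoint (v : V) (c : ZMod m → V) :
    ContinuousOn (starPoint v c) {y | ∀ i, 0 ≤ y i} := by
  refine continuousOn_pi.mpr fun u => ?_
  unfold starPoint
  refine ContinuousOn.div (Continuous.continuousOn ?_) (Continuous.continuousOn ?_) ?_
  · refine continuous_const.add (continuous_finsetSum _ fun i _ => ?_)
    split_ifs <;> fun_prop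
  · fun_prop
  · intro y hy
    have : 0 ≤ ∑ i, y i := Finset.sum_nonneg fun i _ => hy i
    positivity

variable {v : V} {c : ZMod m → V} {y : ZMod m → ℝ}

theorem starPoint_self (hv : ∀ i, c i ≠ v) : starPoint v c y v = 1 / (1 + ∑ i, y i) := by
  simp [starPoint, fun i => (hv i).symm]

theorem starPoint_apply (hv : ∀ i, c i ≠ v) (hc : Function.Injective c) (j : ZMod m) :
    starPoint v c y (c j) = y j / (1 + ∑ i, y i) := by
  simp [starPoint, hv j, hc.eq_iff]

theorem starPoint_of_ne {u : V} (hu : u ≠ v) (h : ∀ i, y i ≠ 0 → u ≠ c i) :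
    starPoint v c y u = 0 := by
  rw [starPoint, if_neg hu, Finset.sum_eq_zero, add_zero, zero_div]
  intro i _
  by_cases hi : y i = 0
  · simp [hi]
  · rw [if_neg (h i hi)]

end StarPoint

/-! ### The realization as a closed surface -/

section Realization

variable {V : Type*} [Fintype V]

/-- The closed cell of the realization that is spanned by `σ`. -/
def cell (σ : Finset V) : Set (V → ℝ) := {w | w ∈ stdSimplex ℝ V ∧ ∀ v, v ∉ σ → w v = 0}

theorem isCompact_cell (σ : Finset V) : IsCompact (cell σ) := by
  have h : cell σ = stdSimplex ℝ V ∩ ⋂ (v) (_ : v ∉ σ), {w | w v = 0} := by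
    ext w
    simp [cell]
  rw [h]
  exact (isCompact_stdSimplex ℝ V).inter_right (isClosed_iInter fun v => isClosed_iInter fun _ =>
    isClosed_eq (continuous_apply v) continuous_const)

theorem convex_cell (σ : Finset V) : Convex ℝ (cell σ) := by
  intro x hx y hy a b ha hb hab
  refine ⟨convex_stdSimplex ℝ V hx.1 hy.1 ha hb hab, fun v hv => ?_⟩
  simp [hx.2 v hv, hy.2 v hv]

theorem cell_subset_realization {K : AbstractSimplicialComplex V} {σ : Finset V}
    (hσ : σ ∈ K.faces) : cell σ ⊆ K.realization := fun _ hw => ⟨hw.1, σ, hσ, hw.2⟩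

theorem realization_eq_iUnion_cell (K : AbstractSimplicialComplex V) :
    K.realization = ⋃ σ ∈ K.faces, cell σ := by
  ext w
  simp only [realization, cell, Set.mem_ofPred_eq, Set.mem_iUnion, exists_prop]
  tauto

theorem isCompact_realization (K : AbstractSimplicialComplex V) : IsCompact K.realization := by
  rw [realization_eq_iUnion_cell]
  exact (Set.toFinite K.faces).isCompact_biUnion fun σ _ => isCompact_cell σ

theorem joinedIn_realization {K : AbstractSimplicialComplex V} {σ : Finset V} (hσ : σ ∈ K.faces)
    {x y : V → ℝ} (hx : x ∈ cell σ) (hy : y ∈ cell σ) : JoinedIn K.realization x y :=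
  (JoinedIn.of_segment_subset ((convex_cell σ).segment_subset hx hy)).mono
    (cell_subset_realization hσ)

variable [DecidableEq V]

theorem single_mem_cell {σ : Finset V} {v : V} (hv : v ∈ σ) : Pi.single v (1 : ℝ) ∈ cell σ :=
  ⟨single_mem_stdSimplex ℝ v, fun u hu => Pi.single_eq_of_ne (by rintro rfl; exact hu hv) _⟩

/-- Cells are convex: edge paths of the 1-skeleton join the vertices, and every point is joined to a
vertex inside a cell containing it. -/
theorem isPathConnected_realization {K : AbstractSimplicialComplex V}
    (hK : K.oneSkeleton.Connected) : IsPathConnected K.realization := by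
  have hv : ∀ u v : V, JoinedIn K.realization (Pi.single u 1) (Pi.single v 1) := by
    intro u v
    obtain ⟨p⟩ := hK.preconnected u v
    induction p with
    | nil =>
      exact joinedIn_realization (K.singleton_mem _)
        (single_mem_cell (Finset.mem_singleton_self _))
        (single_mem_cell (Finset.mem_singleton_self _))
    | cons h _ ih =>
      exact (joinedIn_realization h.2 (single_mem_cell (by simp))
        (single_mem_cell (by simp))).trans ih
  obtain ⟨v⟩ := hK.nonempty
  refine ⟨Pi.single v 1, (hv v v).source_mem, fun {w} hw => ?_⟩
  obtain ⟨hw, σ, hσ, hs⟩ := hw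
  obtain ⟨u, hu⟩ := (K.isRelLowerSet_faces hσ).1
  exact (hv v u).trans (joinedIn_realization hσ (single_mem_cell hu) ⟨hw, hs⟩)

theorem starPoint_mem_stdSimplex {m : ℕ} [NeZero m] {v : V} {c : ZMod m → V} {y : ZMod m → ℝ}
    (hy : ∀ i, 0 ≤ y i) : starPoint v c y ∈ stdSimplex ℝ V := by
  have hs : 0 ≤ ∑ i, y i := Finset.sum_nonneg fun i _ => hy i
  constructor
  · intro u
    refine div_nonneg (add_nonneg (by split_ifs <;> norm_num) (Finset.sum_nonneg fun i _ => ?_))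
      (by positivity)
    split_ifs
    exacts [hy i, le_rfl]
  · simp only [starPoint]
    rw [← Finset.sum_div, Finset.sum_add_distrib, Finset.sum_comm]
    simp only [Finset.sum_ite_eq', Finset.mem_univ, if_true]
    exact div_self (by positivity)

/-- The open star of a vertex whose link is a circle is homeomorphic to the plane. -/
theorem nonempty_openStar_homeomorph {m : ℕ} [NeZero m] {v : V} {c : ZMod m → V}
    {K : AbstractSimplicialComplex V} (hm : 3 ≤ m)
    (hc : Function.Injective c)
    (hL : ∀ σ : Finset V, σ ∈ K.linkFaces v ↔
      σ.Nonempty ∧ ∃ i : ZMod m, (σ : Set V) ⊆ {c i, c (i + 1)}) :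
    Nonempty ({w : K.realization | 0 < (w : V → ℝ) v} ≃ₜ ℂ) := by
  have hv : ∀ i, c i ≠ v := by
    intro i hi
    have := ((hL {c i}).mpr ⟨by simp, i, by simp⟩).2.1
    exact this (by simp [hi])
  have hedge : ∀ i, insert v {c i, c (i + 1)} ∈ K.faces := fun i =>
    ((hL {c i, c (i + 1)}).mpr ⟨by simp, i, by simp⟩).2.2
  have hsupp : ∀ w ∈ K.realization, 0 < w v →
      ∃ i, ∀ u, u ≠ v → u ≠ c i → u ≠ c (i + 1) → w u = 0 := by
    rintro w ⟨-, σ, hσ, hw⟩ hpos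
    have hvσ : v ∈ σ := by
      by_contra h
      exact hpos.ne' (hw v h)
    rcases (σ.erase v).eq_empty_or_nonempty with he | he
    -- Here the point is the vertex `v` itself; any sector would do.
    · refine ⟨0, fun u hu _ _ => hw u fun h => ?_⟩
      have : u ∈ σ.erase v := Finset.mem_erase.mpr ⟨hu, h⟩
      simp [he] at this
    · obtain ⟨-, i, hi⟩ := (hL (σ.erase v)).mp ⟨he, Finset.notMem_erase v σ, by
        rwa [Finset.insert_erase hvσ]⟩
      refine ⟨i, fun u hu h1 h2 => hw u fun h => ?_⟩
      have : u ∈ ({c i, c (i + 1)} : Set V) := hi (by simp [hu, h])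
      simp [h1, h2] at this
  -- Rescaling so that `v` has weight 1 turns the star into the fan; `starPoint` undoes this by
  -- normalizing the total weight.
  let g : {w : K.realization | 0 < (w : V → ℝ) v} → ZMod m → ℝ := fun w i => w.1.1 (c i) / w.1.1 v
  have hg : Continuous g := by
    refine continuous_pi fun i => Continuous.div ?_ ?_ fun w => w.2.ne'
    · exact (continuous_apply _).comp (continuous_subtype_val.comp continuous_subtype_val)
    · exact (continuous_apply _).comp (continuous_subtype_val.comp continuous_subtype_val)
  have hgr : ∀ w, g w ∈ Set.range (fanCoord : ℂ → ZMod m → ℝ) := by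
    intro w
    obtain ⟨i, hi⟩ := hsupp w.1.1 w.1.2 w.2
    refine exists_fanCoord_eq hm (fun j => div_nonneg (w.1.2.1.1 _) w.2.le) (i := i)
      fun j hj hj' => ?_
    simp only [g]
    rw [hi (c j) (hv j) (hc.ne hj) (hc.ne hj'), zero_div]
  have hpt : ∀ z : ℂ, starPoint v c (fanCoord z) ∈ K.realization := by
    intro z
    refine ⟨starPoint_mem_stdSimplex fun i => fanCoord_nonneg z i, ?_⟩
    obtain ⟨i, hi⟩ := exists_fanCoord_support m z
    refine ⟨_, hedge i, fun u hu => ?_⟩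
    simp only [Finset.mem_insert, Finset.mem_singleton, not_or] at hu
    refine starPoint_of_ne hu.1 fun j hj huj => ?_
    refine hj (hi j ?_ ?_)
    · rintro rfl; exact hu.2.1 huj
    · rintro rfl; exact hu.2.2 huj
  have hsum : ∀ z : ℂ, 0 < 1 + ∑ i : ZMod m, fanCoord z i := fun z => by
    rw [sum_fanCoord hm]
    positivity
  let e := (isClosedEmbedding_fanCoord hm).isEmbedding.toHomeomorph
  have he : ∀ y (hy : y ∈ Set.range (fanCoord : ℂ → ZMod m → ℝ)), fanCoord (e.symm ⟨y, hy⟩) = y := by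
    intro y hy
    exact congrArg Subtype.val (e.apply_symm_apply ⟨y, hy⟩)
  refine ⟨{
    toFun := fun w => e.symm ⟨g w, hgr w⟩
    invFun := fun z => ⟨⟨starPoint v c (fanCoord z), hpt z⟩, ?_⟩
    left_inv := ?_
    right_inv := ?_
    continuous_toFun := e.symm.continuous.comp (hg.subtype_mk _)
    continuous_invFun := ?_ }⟩
  · simp only [Set.mem_ofPred_eq]
    rw [starPoint_self hv]
    exact one_div_pos.mpr (hsum z)
  · intro w
    refine Subtype.ext (Subtype.ext (funext fun u => ?_))
    simp only [he]
    have hw : 0 < w.1.1 v := w.2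
    obtain ⟨i, hi⟩ := hsupp w.1.1 w.1.2 hw
    -- No weight lies outside `v` and its link, so the normalizing denominator is the reciprocal of
    -- the weight of `v`.
    have hone : w.1.1 v + ∑ j, w.1.1 (c j) = 1 := by
      rw [← w.1.2.1.2, ← Finset.sum_image (s := Finset.univ) (g := c) (f := w.1.1)
        fun a _ b _ h => hc h, ← Finset.sum_insert (a := v) (by simp [hv])]
      refine Finset.sum_subset (Finset.subset_univ _) fun u _ hu => ?_
      simp only [Finset.mem_insert, Finset.mem_image, Finset.mem_univ, true_and, not_or,
        not_exists] at hu
      exact hi u hu.1 (Ne.symm (hu.2 i)) (Ne.symm (hu.2 (i + 1)))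
    have hden : 1 + ∑ j, g w j = 1 / w.1.1 v := by
      simp only [g]
      rw [← Finset.sum_div, eq_div_iff hw.ne', add_mul, div_mul_cancel₀ _ hw.ne', one_mul, hone]
    by_cases huv : u = v
    · subst huv
      rw [starPoint_self hv, hden, one_div_one_div]
    by_cases huc : ∃ j, u = c j
    · obtain ⟨j, rfl⟩ := huc
      rw [starPoint_apply hv hc, hden]
      simp only [g]
      field_simp
    · push Not at huc
      rw [starPoint_of_ne huv fun j _ => huc j, hi u huv (huc _) (huc _)]
  · intro z
    refine fanCoord_injective hm ?_
    rw [he]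
    funext j
    simp only [g]
    rw [starPoint_self hv, starPoint_apply hv hc]
    have := hsum z
    field_simp
  · refine Continuous.subtype_mk (Continuous.subtype_mk ?_ _) _
    exact (continuousOn_starPoint v c).comp_continuous continuous_fanCoord
      fun z i => fanCoord_nonneg z i

/-- The realization of a triangulated surface is a connected closed surface. -/
theorem IsTriangulatedSurface.isConnectedClosedSurface {K : AbstractSimplicialComplex V}
    (hK : K.IsTriangulatedSurface) : IsConnectedClosedSurface K.realization where
  compact := isCompact_iff_compactSpace.mp K.isCompact_realization
  hausdorff := inferInstance
  connected := isConnected_iff_connectedSpace.mp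
    (isPathConnected_realization hK.connected).isConnected
  locally_euclidean := by
    intro x
    obtain ⟨v, hv⟩ : ∃ v, 0 < (x : V → ℝ) v := by
      by_contra! h
      have h1 := x.2.1.2
      have h2 : ∑ v, (x : V → ℝ) v ≤ 0 := Finset.sum_nonpos fun v _ => h v
      linarith
    obtain ⟨m, c, hm, hc, hL⟩ := hK.link_isCircle v
    have : NeZero m := ⟨by omega⟩
    obtain ⟨e⟩ := nonempty_openStar_homeomorph hm hc hL
    refine ⟨⟨{w | 0 < (w : V → ℝ) v}, ?_⟩, hv,
      ⟨e.trans Complex.orthonormalBasisOneI.repr.toHomeomorph⟩⟩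
    exact isOpen_lt continuous_const ((continuous_apply v).comp continuous_subtype_val)

end Realization

end AbstractSimplicialComplex

/-! ### The link of 0 as an explicit integer cycle -/

section RingelLink

/-- The link of the vertex `0` of the complex `R_{k,8+12k}`, as the sequence of its `12 k + 6`
vertices (followed by the first one again). -/
def ringelLink (k p : ℕ) : ℤ :=
  if p < 4 * k then
    if p % 2 = 0 then (p / 2 : ℕ) + 1
    else if p % 4 = 1 then 3 * k + 3 + (p / 4 : ℕ) else -(5 * k + 2) + (p / 4 : ℕ)
  else if p = 4 * k then -(2 * k + 1)
  else if p < 8 * k + 2 then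
    if (p - 4 * k) % 2 = 0 then -((p - 4 * k) / 2 : ℕ)
    else if (p - 4 * k) % 4 = 1 then 3 * k + 2 - ((p - 4 * k) / 4 : ℕ)
    else -(5 * k + 4) - ((p - 4 * k) / 4 : ℕ)
  else if p < 10 * k + 3 then
    if p % 2 = 0 then 4 * k + 3 + ((p - (8 * k + 2)) / 2 : ℕ)
    else 6 * k + 3 - ((p - (8 * k + 2)) / 2 : ℕ)
  else if p = 10 * k + 3 then 2 * k + 1
  else if p < 12 * k + 5 then
    if p % 2 = 0 then -(2 * k + 2) - ((p - (10 * k + 4)) / 2 : ℕ)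
    else -(4 * k + 2) + ((p - (10 * k + 4)) / 2 : ℕ)
  else if p = 12 * k + 5 then -(5 * k + 3)
  else 1

/-- The position of a vertex in the link of `0`. -/
def ringelPosition (k : ℕ) (u : ℤ) : ℤ :=
  if 0 < u then
    if u ≤ 2 * k then 2 * (u - 1)
    else if u = 2 * k + 1 then 10 * k + 3
    else if u ≤ 3 * k + 2 then 4 * k + 1 + 4 * (3 * k + 2 - u)
    else if u ≤ 4 * k + 2 then 4 * (u - 3 * k - 3) + 1
    else if u ≤ 5 * k + 3 then 8 * k + 2 + 2 * (u - 4 * k - 3)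
    else 8 * k + 3 + 2 * (6 * k + 3 - u)
  else
    if -u ≤ 2 * k then 4 * k - 2 * u
    else if -u = 2 * k + 1 then 4 * k
    else if -u ≤ 3 * k + 2 then 10 * k + 4 + 2 * (-u - 2 * k - 2)
    else if -u ≤ 4 * k + 2 then 10 * k + 5 + 2 * (4 * k + 2 + u)
    else if -u ≤ 5 * k + 2 then 4 * (5 * k + 2 + u) + 3
    else if -u = 5 * k + 3 then 12 * k + 5
    else 4 * k + 3 + 4 * (-u - 5 * k - 4)

/-- This and the following lemmas evaluate the cycle block by block. The position enters through an
equation, so that `omega` can match any expression for it. -/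
theorem ringelLink_ascending_even {k p : ℕ} (t : ℕ) (ht : t < 2 * k) (hp : p = 2 * t) :
    ringelLink k p = t + 1 := by
  unfold ringelLink
  split_ifs <;> omega

theorem ringelLink_ascending_one {k p : ℕ} (t : ℕ) (ht : t < k) (hp : p = 4 * t + 1) :
    ringelLink k p = 3 * k + 3 + t := by
  unfold ringelLink
  split_ifs <;> omega

theorem ringelLink_ascending_three {k p : ℕ} (t : ℕ) (ht : t < k) (hp : p = 4 * t + 3) :
    ringelLink k p = -(5 * k + 2) + t := by
  unfold ringelLink
  split_ifs <;> omega

theorem ringelLink_four_mul {k p : ℕ} (hp : p = 4 * k) : ringelLink k p = -(2 * k + 1) := by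
  unfold ringelLink
  split_ifs <;> omega

theorem ringelLink_descending_even {k p : ℕ} (t : ℕ) (ht : t < 2 * k) (hp : p = 4 * k + 2 + 2 * t) :
    ringelLink k p = -1 - t := by
  unfold ringelLink
  split_ifs <;> omega

theorem ringelLink_descending_one {k p : ℕ} (t : ℕ) (ht : t ≤ k) (hp : p = 4 * k + 1 + 4 * t) :
    ringelLink k p = 3 * k + 2 - t := by
  unfold ringelLink
  split_ifs <;> omega

theorem ringelLink_descending_three {k p : ℕ} (t : ℕ) (ht : t < k) (hp : p = 4 * k + 3 + 4 * t) :
    ringelLink k p = -(5 * k + 4) - t := by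
  unfold ringelLink
  split_ifs <;> omega

theorem ringelLink_positive_even {k p : ℕ} (t : ℕ) (ht : t ≤ k) (hp : p = 8 * k + 2 + 2 * t) :
    ringelLink k p = 4 * k + 3 + t := by
  unfold ringelLink
  split_ifs <;> omega

theorem ringelLink_positive_odd {k p : ℕ} (t : ℕ) (ht : t < k) (hp : p = 8 * k + 3 + 2 * t) :
    ringelLink k p = 6 * k + 3 - t := by
  unfold ringelLink
  split_ifs <;> omega

theorem ringelLink_ten_mul_add {k p : ℕ} (hp : p = 10 * k + 3) : ringelLink k p = 2 * k + 1 := by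
  unfold ringelLink
  split_ifs <;> omega

theorem ringelLink_negative_even {k p : ℕ} (t : ℕ) (ht : t ≤ k) (hp : p = 10 * k + 4 + 2 * t) :
    ringelLink k p = -(2 * k + 2) - t := by
  unfold ringelLink
  split_ifs <;> omega

theorem ringelLink_negative_odd {k p : ℕ} (t : ℕ) (ht : t < k) (hp : p = 10 * k + 5 + 2 * t) :
    ringelLink k p = -(4 * k + 2) + t := by
  unfold ringelLink
  split_ifs <;> omega

theorem ringelLink_last {k p : ℕ} (hp : p = 12 * k + 5) : ringelLink k p = -(5 * k + 3) := by
  unfold ringelLink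
  split_ifs <;> omega

theorem ringelLink_length {k p : ℕ} (hp : p = 12 * k + 6) : ringelLink k p = 1 := by
  unfold ringelLink
  split_ifs <;> omega

/-- The vertices of the link of `0`, by their positions. -/
theorem ringelLink_cases {k p : ℕ} (hp : p < 12 * k + 6) :
    (∃ t : ℕ, t < 2 * k ∧ p = 2 * t ∧ ringelLink k p = t + 1) ∨
    (∃ t : ℕ, t < k ∧ p = 4 * t + 1 ∧ ringelLink k p = 3 * k + 3 + t) ∨
    (∃ t : ℕ, t < k ∧ p = 4 * t + 3 ∧ ringelLink k p = -(5 * k + 2) + t) ∨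
    (p = 4 * k ∧ ringelLink k p = -(2 * k + 1)) ∨
    (∃ t : ℕ, t < 2 * k ∧ p = 4 * k + 2 + 2 * t ∧ ringelLink k p = -1 - t) ∨
    (∃ t : ℕ, t ≤ k ∧ p = 4 * k + 1 + 4 * t ∧ ringelLink k p = 3 * k + 2 - t) ∨
    (∃ t : ℕ, t < k ∧ p = 4 * k + 3 + 4 * t ∧ ringelLink k p = -(5 * k + 4) - t) ∨
    (∃ t : ℕ, t ≤ k ∧ p = 8 * k + 2 + 2 * t ∧ ringelLink k p = 4 * k + 3 + t) ∨
    (∃ t : ℕ, t < k ∧ p = 8 * k + 3 + 2 * t ∧ ringelLink k p = 6 * k + 3 - t) ∨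
    (p = 10 * k + 3 ∧ ringelLink k p = 2 * k + 1) ∨
    (∃ t : ℕ, t ≤ k ∧ p = 10 * k + 4 + 2 * t ∧ ringelLink k p = -(2 * k + 2) - t) ∨
    (∃ t : ℕ, t < k ∧ p = 10 * k + 5 + 2 * t ∧ ringelLink k p = -(4 * k + 2) + t) ∨
    (p = 12 * k + 5 ∧ ringelLink k p = -(5 * k + 3)) := by
  have h : (p < 4 * k ∧ p % 2 = 0) ∨
      (p < 4 * k ∧ p % 4 = 1) ∨
      (p < 4 * k ∧ p % 4 = 3) ∨
      (p = 4 * k) ∨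
      (4 * k < p ∧ p < 8 * k + 2 ∧ (p - 4 * k) % 2 = 0) ∨
      (4 * k < p ∧ p < 8 * k + 2 ∧ (p - 4 * k) % 4 = 1) ∨
      (4 * k < p ∧ p < 8 * k + 2 ∧ (p - 4 * k) % 4 = 3) ∨
      (8 * k + 2 ≤ p ∧ p < 10 * k + 3 ∧ p % 2 = 0) ∨
      (8 * k + 2 ≤ p ∧ p < 10 * k + 3 ∧ p % 2 = 1) ∨
      (p = 10 * k + 3) ∨
      (10 * k + 4 ≤ p ∧ p < 12 * k + 5 ∧ p % 2 = 0) ∨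
      (10 * k + 4 ≤ p ∧ p < 12 * k + 5 ∧ p % 2 = 1) ∨
      (p = 12 * k + 5) := by omega
  rcases h with h | h | h | h | h | h | h | h | h | h | h | h | h
  · left
    exact ⟨p / 2, by omega, by omega, ringelLink_ascending_even _ (by omega) (by omega)⟩
  · iterate 1 right
    left
    exact ⟨p / 4, by omega, by omega, ringelLink_ascending_one _ (by omega) (by omega)⟩
  · iterate 2 right
    left
    exact ⟨p / 4, by omega, by omega, ringelLink_ascending_three _ (by omega) (by omega)⟩
  · iterate 3 right
    left
    exact ⟨h, ringelLink_four_mul h⟩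
  · iterate 4 right
    left
    exact ⟨(p - (4 * k + 2)) / 2, by omega, by omega, ringelLink_descending_even _
      (by omega) (by omega)⟩
  · iterate 5 right
    left
    exact ⟨(p - 4 * k) / 4, by omega, by omega, ringelLink_descending_one _ (by omega) (by omega)⟩
  · iterate 6 right
    left
    exact ⟨(p - 4 * k) / 4, by omega, by omega, ringelLink_descending_three _ (by omega) (by omega)⟩
  · iterate 7 right
    left
    exact ⟨(p - (8 * k + 2)) / 2, by omega, by omega, ringelLink_positive_even _
      (by omega) (by omega)⟩
  · iterate 8 right
    left
    exact ⟨(p - (8 * k + 2)) / 2, by omega, by omega, ringelLink_positive_odd _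
      (by omega) (by omega)⟩
  · iterate 9 right
    left
    exact ⟨h, ringelLink_ten_mul_add h⟩
  · iterate 10 right
    left
    exact ⟨(p - (10 * k + 4)) / 2, by omega, by omega, ringelLink_negative_even _
      (by omega) (by omega)⟩
  · iterate 11 right
    left
    exact ⟨(p - (10 * k + 4)) / 2, by omega, by omega, ringelLink_negative_odd _
      (by omega) (by omega)⟩
  · iterate 12 right
    exact ⟨h, ringelLink_last h⟩

-- An explicit left inverse proves injectivity block by block, which avoids comparing all pairs of
-- blocks.
set_option maxHeartbeats 1600000 in
theorem ringelPosition_ringelLink {k p : ℕ} (hp : p < 12 * k + 6) :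
    ringelPosition k (ringelLink k p) = p := by
  rcases ringelLink_cases hp with ⟨t, ht, rfl, h⟩ | ⟨t, ht, rfl, h⟩ | ⟨t, ht, rfl, h⟩ |
    ⟨rfl, h⟩ | ⟨t, ht, rfl, h⟩ | ⟨t, ht, rfl, h⟩ | ⟨t, ht, rfl, h⟩ | ⟨t, ht, rfl, h⟩ |
    ⟨t, ht, rfl, h⟩ | ⟨rfl, h⟩ | ⟨t, ht, rfl, h⟩ | ⟨t, ht, rfl, h⟩ | ⟨rfl, h⟩ <;>
  rw [h] <;> unfold ringelPosition <;> split_ifs <;> omega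

/-- The bounds keep the values in a range on which reduction modulo 12k + 8 is injective; of the
nonzero residues only 6k + 4 is missing. -/
theorem ringelLink_bounds {k p : ℕ} (hp : p < 12 * k + 6) :
    ringelLink k p ≠ 0 ∧ -(6 * k + 3) ≤ ringelLink k p ∧ ringelLink k p ≤ 6 * k + 3 := by
  rcases ringelLink_cases hp with ⟨t, ht, rfl, h⟩ | ⟨t, ht, rfl, h⟩ | ⟨t, ht, rfl, h⟩ |
    ⟨rfl, h⟩ | ⟨t, ht, rfl, h⟩ | ⟨t, ht, rfl, h⟩ | ⟨t, ht, rfl, h⟩ | ⟨t, ht, rfl, h⟩ |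
    ⟨t, ht, rfl, h⟩ | ⟨rfl, h⟩ | ⟨t, ht, rfl, h⟩ | ⟨t, ht, rfl, h⟩ | ⟨rfl, h⟩ <;>
  rw [h] <;> omega

/-- The generating triangles `[0, a, b]`, with `(a, b)` ordered according to an orientation of
`R_{k,n}` that is invariant under translations. -/
def RingelOriented (k : ℕ) (a b : ℤ) : Prop :=
  (∃ i < k, a = 2 * i + 1 ∧ b = 3 * k + 3 + i) ∨
  (∃ i < k, a = 3 * k + 3 + i ∧ b = 2 * i + 2) ∨
  (∃ i < k, a = 4 * k + 3 + i ∧ b = 6 * k + 3 - i) ∨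
  (∃ i < k, a = 6 * k + 3 - i ∧ b = 4 * k + 4 + i) ∨
  (a = 2 * k + 2 ∧ b = 4 * k + 3) ∨ (a = 5 * k + 3 ∧ b = 2 * k + 1)

/-- The positively oriented triangles `[0, u, v]`. -/
def RingelStep (k : ℕ) (u v : ℤ) : Prop :=
  RingelOriented k u v ∨ RingelOriented k (-v) (u - v) ∨ RingelOriented k (v - u) (-u)

/-- The triangle is translated by -u, so that its corner u becomes the new origin, and the cyclic
order is kept. -/
theorem RingelStep.rotate {k : ℕ} {u v : ℤ} (h : RingelStep k u v) :
    RingelStep k (v - u) (-u) := by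
  rcases h with h | h | h
  · refine Or.inr (Or.inl ?_)
    convert h using 1 <;> ring
  · refine Or.inr (Or.inr ?_)
    convert h using 1 <;> ring
  · exact Or.inl h

/-- The three conclusions belong to the three corners that can be moved to 0. Positions come from
inverting the block formulas. -/
theorem exists_ringelLink_of_ringelOriented {k : ℕ} (hk : 1 ≤ k) {a b : ℤ}
    (h : RingelOriented k a b) :
    (∃ p < 12 * k + 6, ringelLink k p = a ∧ ringelLink k (p + 1) = b) ∧
    (∃ p < 12 * k + 6, ringelLink k p = b - a ∧ ringelLink k (p + 1) = -a) ∧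
    (∃ p < 12 * k + 6, ringelLink k p = -b ∧ ringelLink k (p + 1) = a - b) := by
  rcases h with ⟨i, hi, rfl, rfl⟩ | ⟨i, hi, rfl, rfl⟩ | ⟨i, hi, rfl, rfl⟩ | ⟨i, hi, rfl, rfl⟩ |
    ⟨rfl, rfl⟩ | ⟨rfl, rfl⟩
  · exact ⟨⟨4 * i, by omega, (ringelLink_ascending_even (2 * i) (by omega)
    (by omega)).trans (by omega),
      (ringelLink_ascending_one i (by omega) (by omega)).trans (by omega)⟩,
    ⟨4 * k + 1 + 4 * i, by omega, (ringelLink_descending_one i (by omega)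
      (by omega)).trans (by omega),
      (ringelLink_descending_even (2 * i) (by omega) (by omega)).trans (by omega)⟩,
    ⟨12 * k + 3 - 2 * i, by omega, (ringelLink_negative_odd (k - 1 - i) (by omega)
      (by omega)).trans (by omega),
      (ringelLink_negative_even (k - i) (by omega) (by omega)).trans (by omega)⟩⟩
  · exact ⟨⟨4 * i + 1, by omega, (ringelLink_ascending_one i (by omega) (by omega)).trans
    (by omega),
      (ringelLink_ascending_even (2 * i + 1) (by omega) (by omega)).trans (by omega)⟩,
    ⟨12 * k + 2 - 2 * i, by omega, (ringelLink_negative_even (k - 1 - i) (by omega)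
      (by omega)).trans (by omega),
      (ringelLink_negative_odd (k - 1 - i) (by omega) (by omega)).trans (by omega)⟩,
    ⟨4 * k + 4 + 4 * i, by omega, (ringelLink_descending_even (2 * i + 1) (by omega)
      (by omega)).trans (by omega),
      (ringelLink_descending_one (i + 1) (by omega) (by omega)).trans (by omega)⟩⟩
  · exact ⟨⟨8 * k + 2 + 2 * i, by omega, (ringelLink_positive_even i (by omega)
    (by omega)).trans (by omega),
      (ringelLink_positive_odd i (by omega) (by omega)).trans (by omega)⟩,
    ⟨4 * k - 4 * i - 2, by omega, (ringelLink_ascending_even (2 * k - 2 * i - 1)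
      (by omega) (by omega)).trans (by omega),
      (ringelLink_ascending_three (k - i - 1) (by omega) (by omega)).trans (by omega)⟩,
    ⟨8 * k - 1 - 4 * i, by omega, (ringelLink_descending_three (k - 1 - i) (by omega)
      (by omega)).trans (by omega),
      (ringelLink_descending_even (2 * k - 2 * i - 1) (by omega) (by omega)).trans (by omega)⟩⟩
  · refine ⟨⟨8 * k + 3 + 2 * i, by omega, (ringelLink_positive_odd i (by omega)
    (by omega)).trans (by omega),
      (ringelLink_positive_even (i + 1) (by omega) (by omega)).trans (by omega)⟩,
    ⟨8 * k - 2 - 4 * i, by omega, (ringelLink_descending_even (2 * k - 2 * i - 2)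
      (by omega) (by omega)).trans (by omega),
      (ringelLink_descending_three (k - 1 - i) (by omega) (by omega)).trans (by omega)⟩, ?_⟩
    -- The last triangle of this family closes the cycle, from -(5k + 3) back to 1.
    by_cases hik : i + 1 = k
    · exact ⟨12 * k + 5, by omega, (ringelLink_last (by omega)).trans (by omega),
      (ringelLink_length (by omega)).trans (by omega)⟩
    · exact ⟨4 * k - 5 - 4 * i, by omega, (ringelLink_ascending_three (k - 2 - i)
      (by omega) (by omega)).trans (by omega),
      (ringelLink_ascending_even (2 * k - 2 - 2 * i) (by omega) (by omega)).trans (by omega)⟩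
  · exact ⟨⟨8 * k + 1, by omega, (ringelLink_descending_one k (by omega)
    (by omega)).trans (by omega),
      (ringelLink_positive_even 0 (by omega) (by omega)).trans (by omega)⟩,
    ⟨10 * k + 3, by omega, (ringelLink_ten_mul_add (by omega)).trans (by omega),
      (ringelLink_negative_even 0 (by omega) (by omega)).trans (by omega)⟩,
    ⟨4 * k - 1, by omega, (ringelLink_ascending_three (k - 1) (by omega)
      (by omega)).trans (by omega),
      (ringelLink_four_mul (by omega)).trans (by omega)⟩⟩
  · exact ⟨⟨10 * k + 2, by omega, (ringelLink_positive_even k (by omega)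
    (by omega)).trans (by omega),
      (ringelLink_ten_mul_add (by omega)).trans (by omega)⟩,
    ⟨12 * k + 4, by omega, (ringelLink_negative_even k (by omega) (by omega)).trans (by omega),
      (ringelLink_last (by omega)).trans (by omega)⟩,
    ⟨4 * k, by omega, (ringelLink_four_mul (by omega)).trans (by omega),
      (ringelLink_descending_one 0 (by omega) (by omega)).trans (by omega)⟩⟩

/-- Converse of the previous lemma: the cycle contains no foreign steps. The case splits inside the
blocks separate their ends, and the residues modulo 4 where two sequences alternate. -/
theorem ringelStep_ringelLink {k p : ℕ} (hk : 1 ≤ k) (hp : p < 12 * k + 6) :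
    RingelStep k (ringelLink k p) (ringelLink k (p + 1)) := by
  unfold RingelStep RingelOriented
  rcases ringelLink_cases hp with ⟨t, ht, rfl, h⟩ | ⟨t, ht, rfl, h⟩ | ⟨t, ht, rfl, h⟩ |
    ⟨rfl, h⟩ | ⟨t, ht, rfl, h⟩ | ⟨t, ht, rfl, h⟩ | ⟨t, ht, rfl, h⟩ | ⟨t, ht, rfl, h⟩ |
    ⟨t, ht, rfl, h⟩ | ⟨rfl, h⟩ | ⟨t, ht, rfl, h⟩ | ⟨t, ht, rfl, h⟩ | ⟨rfl, h⟩
  · by_cases ht2 : t % 2 = 0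
    · rw [h, ringelLink_ascending_one (t / 2) (by omega) (by omega)]
      left
      exact Or.inl ⟨t / 2, by omega, by omega, by omega⟩
    · rw [h, ringelLink_ascending_three (t / 2) (by omega) (by omega)]
      right; left
      exact Or.inr <| Or.inr <| Or.inl ⟨k - 1 - t / 2, by omega, by omega, by omega⟩
  · rw [h, ringelLink_ascending_even (2 * t + 1) (by omega) (by omega)]
    left
    exact Or.inr <| Or.inl ⟨t, by omega, by omega, by omega⟩
  · by_cases htk : t + 1 = k
    · rw [h, ringelLink_four_mul (by omega)]
      right; right
      exact Or.inr <| Or.inr <| Or.inr <| Or.inr <| Or.inl ⟨by omega, by omega⟩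
    · rw [h, ringelLink_ascending_even (2 * t + 2) (by omega) (by omega)]
      right; right
      exact Or.inr <| Or.inr <| Or.inr <| Or.inl ⟨k - 2 - t, by omega, by omega, by omega⟩
  · rw [h, ringelLink_descending_one 0 (by omega) (by omega)]
    right; right
    exact Or.inr <| Or.inr <| Or.inr <| Or.inr <| Or.inr <| ⟨by omega, by omega⟩
  · by_cases ht2 : t % 2 = 0
    · rw [h, ringelLink_descending_three (t / 2) (by omega) (by omega)]
      right; left
      exact Or.inr <| Or.inr <| Or.inr <| Or.inl ⟨k - 1 - t / 2, by omega, by omega, by omega⟩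
    · rw [h, ringelLink_descending_one (t / 2 + 1) (by omega) (by omega)]
      right; right
      exact Or.inr <| Or.inl ⟨t / 2, by omega, by omega, by omega⟩
  · by_cases htk : t = k
    · rw [h, ringelLink_positive_even 0 (by omega) (by omega)]
      left
      exact Or.inr <| Or.inr <| Or.inr <| Or.inr <| Or.inl ⟨by omega, by omega⟩
    · rw [h, ringelLink_descending_even (2 * t) (by omega) (by omega)]
      right; left
      exact Or.inl ⟨t, by omega, by omega, by omega⟩
  · rw [h, ringelLink_descending_even (2 * t + 1) (by omega) (by omega)]
    right; right
    exact Or.inr <| Or.inr <| Or.inl ⟨k - 1 - t, by omega, by omega, by omega⟩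
  · by_cases htk : t = k
    · rw [h, ringelLink_ten_mul_add (by omega)]
      left
      exact Or.inr <| Or.inr <| Or.inr <| Or.inr <| Or.inr <| ⟨by omega, by omega⟩
    · rw [h, ringelLink_positive_odd t (by omega) (by omega)]
      left
      exact Or.inr <| Or.inr <| Or.inl ⟨t, by omega, by omega, by omega⟩
  · rw [h, ringelLink_positive_even (t + 1) (by omega) (by omega)]
    left
    exact Or.inr <| Or.inr <| Or.inr <| Or.inl ⟨t, by omega, by omega, by omega⟩
  · rw [h, ringelLink_negative_even 0 (by omega) (by omega)]
    right; left
    exact Or.inr <| Or.inr <| Or.inr <| Or.inr <| Or.inl ⟨by omega, by omega⟩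
  · by_cases htk : t = k
    · rw [h, ringelLink_last (by omega)]
      right; left
      exact Or.inr <| Or.inr <| Or.inr <| Or.inr <| Or.inr <| ⟨by omega, by omega⟩
    · rw [h, ringelLink_negative_odd t (by omega) (by omega)]
      right; left
      exact Or.inr <| Or.inl ⟨k - 1 - t, by omega, by omega, by omega⟩
  · rw [h, ringelLink_negative_even (t + 1) (by omega) (by omega)]
    right; right
    exact Or.inl ⟨k - 1 - t, by omega, by omega, by omega⟩
  · rw [h, ringelLink_length (by omega)]
    right; right
    exact Or.inr <| Or.inr <| Or.inr <| Or.inl ⟨k - 1, by omega, by omega, by omega⟩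

theorem RingelStep.exists_ringelLink {k : ℕ} (hk : 1 ≤ k) {u v : ℤ}
    (h : RingelStep k u v) :
    ∃ p < 12 * k + 6, ringelLink k p = u ∧ ringelLink k (p + 1) = v := by
  rcases h with h | h | h
  · exact (exists_ringelLink_of_ringelOriented hk h).1
  · simpa using (exists_ringelLink_of_ringelOriented hk h).2.1
  · simpa using (exists_ringelLink_of_ringelOriented hk h).2.2

end RingelLink

/-! ### From the integer cycle to the complex over ℤ/(8 + 12k) -/

section RingelSurface

open AbstractSimplicialComplex

/-- Two of the separately listed generators extend the regular families: [0, 4k+3, 6k+3] is the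
member i = 0 of the third, and [0, 5k+3, 5k+4] the member i = k - 1 of the fourth. -/
theorem ringelOriented_of_mem_ringelGenerators {k : ℕ} (hk : 1 ≤ k) {p : ℕ × ℕ}
    (hp : p ∈ ringelGenerators k) : RingelOriented k p.1 p.2 ∨ RingelOriented k p.2 p.1 := by
  unfold RingelOriented
  rcases hp with ((⟨i, hi, rfl | rfl⟩ | hp) | ⟨i, hi, rfl | rfl⟩) | hp
  · exact Or.inl <| Or.inl ⟨i, hi, by push_cast; omega⟩
  · exact Or.inr <| Or.inr <| Or.inl ⟨i, hi, by push_cast; omega⟩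
  · rcases hp with rfl | hp
    · exact Or.inl <| Or.inr <| Or.inr <| Or.inl ⟨0, hk, by push_cast; omega⟩
    · rw [Set.mem_singleton_iff] at hp
      subst hp
      exact Or.inl <| Or.inr <| Or.inr <| Or.inr <| Or.inr <| Or.inl (by push_cast; omega)
  · exact Or.inl <| Or.inr <| Or.inr <| Or.inl ⟨i + 1, by omega, by push_cast; omega⟩
  · exact Or.inr <| Or.inr <| Or.inr <| Or.inr <| Or.inl ⟨i, by omega, by push_cast; omega⟩
  · rcases hp with rfl | hp
    · exact Or.inr <| Or.inr <| Or.inr <| Or.inr <| Or.inr <| Or.inr (by push_cast; omega)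
    · rw [Set.mem_singleton_iff] at hp
      subst hp
      exact Or.inr <| Or.inr <| Or.inr <| Or.inr <| Or.inl ⟨k - 1, by omega, by push_cast; omega⟩

theorem RingelOriented.exists_mem_ringelGenerators {k : ℕ} {a b : ℤ} (h : RingelOriented k a b) :
    ∃ p ∈ ringelGenerators k, (a = p.1 ∧ b = p.2) ∨ (a = p.2 ∧ b = p.1) := by
  rcases h with ⟨i, hi, h⟩ | ⟨i, hi, h⟩ | ⟨i, hi, h⟩ | ⟨i, hi, h⟩ | h | h
  · exact ⟨(2 * i + 1, 3 * k + 3 + i), Or.inl <| Or.inl <| Or.inl ⟨i, hi, Or.inl rfl⟩,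
      Or.inl (by push_cast; omega)⟩
  · exact ⟨(2 * i + 2, 3 * k + 3 + i), Or.inl <| Or.inl <| Or.inl ⟨i, hi, Or.inr rfl⟩,
      Or.inr (by push_cast; omega)⟩
  · rcases i with _ | i
    · exact ⟨(4 * k + 3, 6 * k + 3), Or.inl <| Or.inl <| Or.inr <| Or.inl rfl,
        Or.inl (by push_cast; omega)⟩
    · exact ⟨(4 * k + 4 + i, 6 * k + 2 - i), Or.inl <| Or.inr ⟨i, by omega, Or.inl rfl⟩,
        Or.inl (by dsimp only; omega)⟩
  · by_cases hik : i < k - 1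
    · exact ⟨(4 * k + 4 + i, 6 * k + 3 - i), Or.inl <| Or.inr ⟨i, hik, Or.inr rfl⟩,
        Or.inr (by dsimp only; omega)⟩
    · exact ⟨(5 * k + 3, 5 * k + 4), Or.inr <| Or.inr rfl, Or.inr (by push_cast; omega)⟩
  · exact ⟨(2 * k + 2, 4 * k + 3), Or.inl <| Or.inl <| Or.inr <| Or.inr rfl,
      Or.inl (by push_cast; omega)⟩
  · exact ⟨(2 * k + 1, 5 * k + 3), Or.inr <| Or.inl rfl, Or.inr (by push_cast; omega)⟩

/-- The link of the vertex `0` as a cycle in `ℤ/(8 + 12 k)`. -/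
def ringelCycle (k : ℕ) (i : ZMod (12 * k + 6)) : ZMod (8 + 12 * k) := (ringelLink k i.val : ℤ)

theorem intCast_ringel_injOn {k : ℕ} {a b : ℤ} (ha : -(6 * k + 3) ≤ a ∧ a ≤ 6 * k + 3)
    (hb : -(6 * k + 3) ≤ b ∧ b ≤ 6 * k + 3) (h : (a : ZMod (8 + 12 * k)) = b) : a = b := by
  rw [ZMod.intCast_eq_intCast_iff_dvd_sub] at h
  have := Int.eq_zero_of_abs_lt_dvd h (by rw [abs_lt]; push_cast; omega)
  omega

theorem ringelCycle_injective (k : ℕ) : Function.Injective (ringelCycle k) := by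
  intro i j h
  have hi := ringelLink_bounds (ZMod.val_lt i)
  have hj := ringelLink_bounds (ZMod.val_lt j)
  have h' := intCast_ringel_injOn hi.2 hj.2 h
  apply ZMod.val_injective
  have := ringelPosition_ringelLink (ZMod.val_lt i)
  rw [h', ringelPosition_ringelLink (ZMod.val_lt j)] at this
  exact_mod_cast this.symm

theorem ringelCycle_ne_zero (k : ℕ) (i : ZMod (12 * k + 6)) : ringelCycle k i ≠ 0 := by
  intro h
  have hi := ringelLink_bounds (ZMod.val_lt i)
  exact hi.1 (intCast_ringel_injOn hi.2 (by omega) (by simpa [ringelCycle] using h))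

/-- At the wrap-around this uses that `ringelLink` repeats its first value at position 12k + 6. -/
theorem ringelCycle_add_one {k : ℕ} (hk : 1 ≤ k) (i : ZMod (12 * k + 6)) :
    ringelCycle k (i + 1) = (ringelLink k (i.val + 1) : ℤ) := by
  rw [ringelCycle]
  rcases (Nat.succ_le_of_lt (ZMod.val_lt i)).lt_or_eq with h | h
  · rw [ZMod.val_add_of_lt] <;> rw [ZMod.val_one'' (by omega)]
    exact h
  · have hi : i + 1 = 0 := by
      rw [← ZMod.natCast_zmod_val i, ← Nat.cast_succ, h, ZMod.natCast_self]
    rw [hi, ZMod.val_zero, ringelLink_length (p := i.val + 1) (by omega),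
      ringelLink_ascending_even (p := 0) 0 (by omega) (by omega)]
    rfl

/-- The relation "`[0, u, v]` is a positively oriented triangle" on `ℤ/(8 + 12 k)`. -/
def RingelNext (k : ℕ) (u v : ZMod (8 + 12 * k)) : Prop :=
  ∃ a b : ℤ, RingelStep k a b ∧ (a : ZMod (8 + 12 * k)) = u ∧ (b : ZMod (8 + 12 * k)) = v

/-- Positive triangles at 0 become successive positions on one injective cycle, so uniqueness and
asymmetry reduce to arithmetic in ℤ/(12k + 6). -/
theorem ringelNext_iff {k : ℕ} (hk : 1 ≤ k) {u v : ZMod (8 + 12 * k)} :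
    RingelNext k u v ↔ ∃ i, ringelCycle k i = u ∧ ringelCycle k (i + 1) = v := by
  constructor
  · rintro ⟨a, b, h, rfl, rfl⟩
    obtain ⟨p, hp, rfl, rfl⟩ := h.exists_ringelLink hk
    refine ⟨p, ?_, ?_⟩
    · rw [ringelCycle, ZMod.val_cast_of_lt hp]
    · rw [ringelCycle_add_one hk, ZMod.val_cast_of_lt hp]
  · rintro ⟨i, rfl, rfl⟩
    exact ⟨_, _, ringelStep_ringelLink hk (ZMod.val_lt i), rfl, (ringelCycle_add_one hk i).symm⟩

theorem RingelNext.rotate {k : ℕ} {u v : ZMod (8 + 12 * k)} (h : RingelNext k u v) :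
    RingelNext k (v - u) (-u) := by
  obtain ⟨a, b, h, rfl, rfl⟩ := h
  exact ⟨_, _, h.rotate, by push_cast; rfl, by push_cast; rfl⟩

theorem RingelNext.rotate' {k : ℕ} {u v : ZMod (8 + 12 * k)} (h : RingelNext k u v) :
    RingelNext k (-v) (u - v) := by
  convert h.rotate.rotate using 1 <;> ring

theorem RingelNext.ne {k : ℕ} (hk : 1 ≤ k) {u v : ZMod (8 + 12 * k)} (h : RingelNext k u v) :
    u ≠ 0 ∧ v ≠ 0 ∧ u ≠ v := by
  obtain ⟨i, rfl, rfl⟩ := (ringelNext_iff hk).mp h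
  exact ⟨ringelCycle_ne_zero k i, ringelCycle_ne_zero k _,
    fun h => ZMod_add_one_ne (by omega) i (ringelCycle_injective k h).symm⟩

theorem RingelNext.asymm {k : ℕ} (hk : 1 ≤ k) {u v : ZMod (8 + 12 * k)} (h : RingelNext k u v) :
    ¬ RingelNext k v u := by
  intro h'
  obtain ⟨i, rfl, rfl⟩ := (ringelNext_iff hk).mp h
  obtain ⟨j, hj, hj'⟩ := (ringelNext_iff hk).mp h'
  have h1 := ringelCycle_injective k hj
  have h2 := ringelCycle_injective k hj'
  apply ZMod_two_ne_zero (m := 12 * k + 6) (by omega)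
  linear_combination h2 - h1

theorem RingelNext.right_unique {k : ℕ} (hk : 1 ≤ k) {u v w : ZMod (8 + 12 * k)}
    (h : RingelNext k u v) (h' : RingelNext k u w) : v = w := by
  obtain ⟨i, rfl, rfl⟩ := (ringelNext_iff hk).mp h
  obtain ⟨j, hj, rfl⟩ := (ringelNext_iff hk).mp h'
  rw [ringelCycle_injective k hj]

theorem RingelOriented.ringelNext {k : ℕ} {a b : ℤ} (h : RingelOriented k a b) :
    RingelNext k a b := ⟨a, b, Or.inl h, rfl, rfl⟩

theorem RingelOriented.exists_triangle_subset {k : ℕ} {a b : ℤ} (h : RingelOriented k a b)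
    {x y z : ZMod (8 + 12 * k)} (hy : y = x + a) (hz : z = x + b) :
    ∃ x' : ZMod (8 + 12 * k), ∃ p ∈ ringelGenerators k,
      ({x, y, z} : Set (ZMod (8 + 12 * k))) ⊆ {x', x' + (p.1 : ZMod _), x' + (p.2 : ZMod _)} := by
  obtain ⟨p, hp, ⟨rfl, rfl⟩ | ⟨rfl, rfl⟩⟩ := h.exists_mem_ringelGenerators
  · refine ⟨x, p, hp, ?_⟩
    subst hy hz
    simp
  · refine ⟨x, p, hp, ?_⟩
    subst hy hz
    rw [Set.pair_comm]
    simp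

theorem RingelNext.mem_faces {k : ℕ} {u v : ZMod (8 + 12 * k)} (h : RingelNext k u v)
    (x : ZMod (8 + 12 * k)) {σ : Finset (ZMod (8 + 12 * k))} (hne : σ.Nonempty)
    (hσ : (σ : Set (ZMod (8 + 12 * k))) ⊆ {x, x + u, x + v}) :
    σ ∈ (ringelComplex k (8 + 12 * k)).faces := by
  refine ⟨hne, ?_⟩
  obtain ⟨a, b, h | h | h, rfl, rfl⟩ := h
  · obtain ⟨x', p, hp, hs⟩ := h.exists_triangle_subset (x := x) rfl rfl
    exact ⟨x', p, hp, hσ.trans hs⟩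
  -- The corner of the triangle that plays the role of 0 in the generator is now `x + b`.
  · obtain ⟨x', p, hp, hs⟩ := h.exists_triangle_subset (x := x + b) (y := x) (z := x + a)
      (by push_cast; ring) (by push_cast; ring)
    refine ⟨x', p, hp, hσ.trans (subset_trans ?_ hs)⟩
    intro y
    simp only [Set.mem_insert_iff, Set.mem_singleton_iff]
    tauto
  · obtain ⟨x', p, hp, hs⟩ := h.exists_triangle_subset (x := x + a) (y := x + b) (z := x)
      (by push_cast; ring) (by push_cast; ring)
    refine ⟨x', p, hp, hσ.trans (subset_trans ?_ hs)⟩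
    intro y
    simp only [Set.mem_insert_iff, Set.mem_singleton_iff]
    tauto

/-- In a translate of a generator, `x` may be any of the three corners; rotation reduces all of them
to `x` as the origin. -/
theorem mem_linkFaces_ringelComplex {k : ℕ} (hk : 1 ≤ k) (x : ZMod (8 + 12 * k))
    (σ : Finset (ZMod (8 + 12 * k))) :
    σ ∈ (ringelComplex k (8 + 12 * k)).linkFaces x ↔
      σ.Nonempty ∧ ∃ u v, RingelNext k u v ∧
        (σ : Set (ZMod (8 + 12 * k))) ⊆ {x + u, x + v} := by
  constructor
  · rintro ⟨hne, hx, -, y, p, hp, hσ⟩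
    refine ⟨hne, ?_⟩
    have key : ∀ u v : ZMod (8 + 12 * k), RingelNext k u v ∨ RingelNext k v u →
        (∀ z ∈ σ, z = x ∨ z = x + u ∨ z = x + v) →
        ∃ u v, RingelNext k u v ∧ (σ : Set (ZMod (8 + 12 * k))) ⊆ {x + u, x + v} := by
      intro u v h hz
      have hs : (σ : Set (ZMod (8 + 12 * k))) ⊆ {x + u, x + v} := by
        intro z hzσ
        rcases hz z hzσ with rfl | h | h
        · exact absurd hzσ hx
        · exact Or.inl h
        · exact Or.inr h
      rcases h with h | h
      · exact ⟨u, v, h, hs⟩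
      · exact ⟨v, u, h, by rwa [Set.pair_comm]⟩
    have hmem : ∀ z ∈ σ, z = y ∨ z = y + p.1 ∨ z = y + p.2 := fun z hz => by
      simpa using hσ (by simp [hz] : z ∈ (insert x σ : Finset _))
    have hxmem : x = y ∨ x = y + p.1 ∨ x = y + p.2 := by
      simpa using hσ (by simp : x ∈ (insert x σ : Finset _))
    have hG : RingelNext k p.1 p.2 ∨ RingelNext k p.2 p.1 := by
      simpa using (ringelOriented_of_mem_ringelGenerators hk hp).imp
        RingelOriented.ringelNext RingelOriented.ringelNext
    rcases hxmem with h | h | h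
    · exact key p.1 p.2 hG fun z hz => by simpa [h] using hmem z hz
    · refine key (p.2 - p.1) (-p.1) (hG.imp (·.rotate) (·.rotate')) fun z hz => ?_
      rcases hmem z hz with h' | h' | h'
      · exact Or.inr (Or.inr (by rw [h, h']; ring))
      · exact Or.inl (by rw [h, h'])
      · exact Or.inr (Or.inl (by rw [h, h']; ring))
    · refine key (-p.2) (p.1 - p.2) (hG.imp (·.rotate') (·.rotate)) fun z hz => ?_
      rcases hmem z hz with h' | h' | h'
      · exact Or.inr (Or.inl (by rw [h, h']; ring))
      · exact Or.inr (Or.inr (by rw [h, h']; ring))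
      · exact Or.inl (by rw [h, h'])
  · rintro ⟨hne, u, v, h, hσ⟩
    refine ⟨hne, fun hx => ?_, h.mem_faces x (Finset.insert_nonempty x σ) ?_⟩
    · have hx' : x = x + u ∨ x = x + v := by simpa using hσ hx
      have := h.ne hk
      simp only [left_eq_add] at hx'
      tauto
    · rw [Finset.coe_insert]
      exact Set.insert_subset_insert hσ

theorem mem_linkFaces_ringelComplex_iff_ringelCycle {k : ℕ} (hk : 1 ≤ k) (x : ZMod (8 + 12 * k))
    (σ : Finset (ZMod (8 + 12 * k))) :
    σ ∈ (ringelComplex k (8 + 12 * k)).linkFaces x ↔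
      σ.Nonempty ∧ ∃ i, (σ : Set (ZMod (8 + 12 * k))) ⊆
        {x + ringelCycle k i, x + ringelCycle k (i + 1)} := by
  rw [mem_linkFaces_ringelComplex hk]
  refine and_congr_right fun _ => ⟨?_, ?_⟩
  · rintro ⟨u, v, h, hσ⟩
    obtain ⟨i, rfl, rfl⟩ := (ringelNext_iff hk).mp h
    exact ⟨i, hσ⟩
  · rintro ⟨i, hσ⟩
    exact ⟨_, _, (ringelNext_iff hk).mpr ⟨i, rfl, rfl⟩, hσ⟩

/-- The generator [0, 1, 3k+3] supplies all edges between `x` and `x + 1`. -/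
theorem ringelComplex_oneSkeleton_connected {k : ℕ} (hk : 1 ≤ k) :
    (ringelComplex k (8 + 12 * k)).oneSkeleton.Connected := by
  have hor : RingelOriented k 1 (3 * k + 3) := Or.inl ⟨0, hk, by norm_num, by norm_num⟩
  have hnext := hor.ringelNext
  rw [Int.cast_one] at hnext
  have hadj : ∀ x, (ringelComplex k (8 + 12 * k)).oneSkeleton.Adj x (x + 1) := by
    refine fun x => ⟨?_, hnext.mem_faces x (by simp) ?_⟩
    · simpa using (hnext.ne hk).1
    · intro y
      simp only [Finset.coe_insert, Finset.coe_singleton, Set.mem_insert_iff,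
        Set.mem_singleton_iff]
      tauto
  have hreach : ∀ j : ℕ, (ringelComplex k (8 + 12 * k)).oneSkeleton.Reachable 0 j := by
    intro j
    induction j with
    | zero => rw [Nat.cast_zero]
    | succ j ih =>
      rw [Nat.cast_succ]
      exact ih.trans (hadj _).reachable
  refine ⟨fun x y => ?_⟩
  have hx := hreach x.val
  have hy := hreach y.val
  rw [ZMod.natCast_zmod_val] at hx hy
  exact hx.symm.trans hy

theorem ringelComplex_isTriangulatedSurface {k : ℕ} (hk : 1 ≤ k) :
    (ringelComplex k (8 + 12 * k)).IsTriangulatedSurface where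
  connected := ringelComplex_oneSkeleton_connected hk
  link_isCircle x := ⟨12 * k + 6, fun i => x + ringelCycle k i, by omega,
    fun _ _ h => ringelCycle_injective k (add_left_cancel h),
    mem_linkFaces_ringelComplex_iff_ringelCycle hk x⟩

/-- The orientation is translation invariant. Opposite directions on common edges mean that a
directed edge has only one successor in the link of its initial vertex. -/
theorem ringelComplex_isOrientable {k : ℕ} (hk : 1 ≤ k) :
    (ringelComplex k (8 + 12 * k)).IsOrientable := by
  have hrot : ∀ a b c : ZMod (8 + 12 * k), RingelNext k (b - a) (c - a) →
      RingelNext k (c - b) (a - b) := by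
    intro a b c h
    convert h.rotate using 1 <;> ring
  refine ⟨fun a b c => RingelNext k (b - a) (c - a), ?_, hrot, ?_, ?_⟩
  · intro a b c h
    obtain ⟨h1, h2, h3⟩ := h.ne hk
    refine ⟨(sub_ne_zero.mp h1).symm, fun h => h3 (by rw [h]), (sub_ne_zero.mp h2).symm,
      h.mem_faces a (by simp) (by simp)⟩
  · intro a b c hab hbc hac hface
    have hlink : ({b, c} : Finset _) ∈ (ringelComplex k (8 + 12 * k)).linkFaces a :=
      ⟨by simp, by simp [hab, hac], hface⟩
    obtain ⟨-, u, v, h, hs⟩ := (mem_linkFaces_ringelComplex hk a _).mp hlink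
    have hb : b = a + u ∨ b = a + v := by simpa using hs (by simp : b ∈ ({b, c} : Finset _))
    have hc : c = a + u ∨ c = a + v := by simpa using hs (by simp : c ∈ ({b, c} : Finset _))
    have hor : RingelNext k (b - a) (c - a) ∨ RingelNext k (c - a) (b - a) := by
      rcases hb with rfl | rfl <;> rcases hc with rfl | rfl
      · exact absurd rfl hbc
      · left; simpa using h
      · right; simpa using h
      · exact absurd rfl hbc
    -- Both sides are the same cyclic order, based at `b` and at `a`; one rotation leads forth and
    -- two lead back.
    have hswap : RingelNext k (a - b) (c - b) ↔ RingelNext k (c - a) (b - a) :=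
      ⟨fun h => hrot _ _ _ h, fun h => hrot _ _ _ (hrot _ _ _ h)⟩
    beta_reduce
    rw [hswap]
    exact ⟨fun h => h.asymm hk, fun h => hor.resolve_right h⟩
  · intro a b c d h h'
    exact sub_left_injective (h.right_unique hk h')

theorem ringelComplex_faceNumber_zero (k : ℕ) :
    (ringelComplex k (8 + 12 * k)).faceNumber 0 = 8 + 12 * k := by
  rw [faceNumber_zero, ZMod.card]

theorem ringelComplex_eulerChar {k : ℕ} (hk : 1 ≤ k) :
    (ringelComplex k (8 + 12 * k)).eulerChar = -2 * k * (8 + 12 * k) := by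
  have h1 := (ringelComplex k (8 + 12 * k)).sum_ncard_linkFaces one_ne_zero
  have h2 := (ringelComplex_isTriangulatedSurface hk).two_mul_faceNumber_one
  have hlink : ∀ x, {σ | σ ∈ (ringelComplex k (8 + 12 * k)).linkFaces x ∧ σ.card = 1}.ncard =
      12 * k + 6 := fun x =>
    ncard_circle_vertices (c := fun i => x + ringelCycle k i)
      (fun _ _ h => ringelCycle_injective k (add_left_cancel h))
      (mem_linkFaces_ringelComplex_iff_ringelCycle hk x)
  simp only [hlink, Finset.sum_const, Finset.card_univ, ZMod.card, smul_eq_mul] at h1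
  rw [eulerChar, ringelComplex_faceNumber_zero]
  zify at h1 h2
  push_cast
  linarith

theorem ringelComplex_hasVertexTransitiveCyclicSymmetry (k n : ℕ) :
    (ringelComplex k n).HasVertexTransitiveCyclicSymmetry := by
  have hpow : ∀ j : ℤ, Equiv.addLeft (1 : ZMod n) ^ j = Equiv.addLeft (j : ZMod n) := by
    intro j
    induction j with
    | zero => ext x; simp
    | succ j ih =>
      rw [zpow_add_one, ih]
      ext x
      simp
    | pred j ih =>
      rw [zpow_sub_one, ih, mul_inv_eq_iff_eq_mul]
      ext x
      simp
      ring
  have hmap : ∀ (t : ZMod n) (σ : Finset (ZMod n)), σ ∈ (ringelComplex k n).faces →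
      σ.map (Equiv.addLeft t).toEmbedding ∈ (ringelComplex k n).faces := by
    rintro t σ ⟨hne, x, p, hp, hσ⟩
    refine ⟨hne.map, t + x, p, hp, ?_⟩
    intro y hy
    simp only [Finset.coe_map, Set.mem_image, Finset.mem_coe] at hy
    obtain ⟨z, hz, rfl⟩ := hy
    have := hσ hz
    simp only [Set.mem_insert_iff, Set.mem_singleton_iff, Equiv.coe_toEmbedding,
      Equiv.coe_addLeft, add_assoc, add_right_inj] at this ⊢
    exact this
  have hinv : ∀ (t : ZMod n) (σ : Finset (ZMod n)),
      (σ.map (Equiv.addLeft t).toEmbedding).map (Equiv.addLeft (-t)).toEmbedding = σ := by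
    intro t σ
    rw [Finset.map_map]
    convert Finset.map_refl using 2
    ext x
    simp
  refine ⟨Subgroup.zpowers (Equiv.addLeft 1), ?_, inferInstance, ⟨fun x y => ?_⟩⟩
  · rw [Subgroup.zpowers_le]
    intro σ
    refine ⟨fun h => ?_, hmap 1 σ⟩
    have := hmap (-1) _ h
    rwa [hinv] at this
  · obtain ⟨j, hj⟩ := ZMod.intCast_surjective (y - x)
    refine ⟨⟨Equiv.addLeft (1 : ZMod n) ^ j, j, rfl⟩, ?_⟩
    change (Equiv.addLeft (1 : ZMod n) ^ j) x = y
    rw [hpow, hj]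
    simp

/-- The root lies in the interval (24k + 7, 24k + 9], as comparison of squares shows. -/
theorem ceil_heawood_ringel {k : ℕ} (hk : 1 ≤ k) :
    ⌈(7 + √(49 - 24 * (-2 * k * (8 + 12 * k)))) / 2⌉ = 8 + 12 * (k : ℤ) := by
  have hk' : (1 : ℝ) ≤ k := by exact_mod_cast hk
  have h1 : (7 + 24 * k : ℝ) < √(49 - 24 * (-2 * k * (8 + 12 * k))) :=
    Real.lt_sqrt_of_sq_lt (by nlinarith)
  have h2 : √(49 - 24 * (-2 * k * (8 + 12 * k))) ≤ (9 + 24 * k : ℝ) :=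
    Real.sqrt_le_iff.mpr ⟨by positivity, by nlinarith⟩
  rw [Int.ceil_eq_iff]
  push_cast
  constructor <;> linarith

end RingelSurface

theorem mainTheorem5 (k : ℕ) (hk : 1 ≤ k) :
    -- it triangulates the orientable surface with `χ = -2kn`, where `n = 8 + 12 k`
    (ringelComplex k (8 + 12 * k)).TriangulatesOrientableSurface (-2 * k * (8 + 12 * k)) ∧
    IsConnectedClosedSurface (ringelComplex k (8 + 12 * k)).realization ∧
    -- it has `n` vertices
    (ringelComplex k (8 + 12 * k)).faceNumber 0 = 8 + 12 * k ∧
    -- it is vertex-minimal among all triangulations of that surface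
    (∀ (W : Type*) [Fintype W] [DecidableEq W] (K : AbstractSimplicialComplex W),
      K.TriangulatesOrientableSurface (-2 * k * (8 + 12 * k)) →
        (ringelComplex k (8 + 12 * k)).faceNumber 0 ≤ K.faceNumber 0) ∧
    -- its number of vertices equals Heawood's lower bound
    (((ringelComplex k (8 + 12 * k)).faceNumber 0 : ℕ) : ℤ) =
      ⌈(7 + √(49 - 24 * ((ringelComplex k (8 + 12 * k)).eulerChar : ℝ))) / 2⌉ ∧
    -- it has vertex-transitive cyclic symmetry
    (ringelComplex k (8 + 12 * k)).HasVertexTransitiveCyclicSymmetry := by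
  have hK := ringelComplex_isTriangulatedSurface hk
  have hχ := ringelComplex_eulerChar hk
  refine ⟨⟨hK, ringelComplex_isOrientable hk, hχ⟩, hK.isConnectedClosedSurface,
    ringelComplex_faceNumber_zero k, ?_, ?_, ringelComplex_hasVertexTransitiveCyclicSymmetry k _⟩
  · intro W _ _ K hKW
    have h := hKW.isTriangulatedSurface.heawood
    rw [hKW.eulerChar_eq] at h
    rw [ringelComplex_faceNumber_zero]
    by_contra! hlt
    zify at hlt
    -- If f₀ ≤ n - 1, then f₀(f₀ - 7) ≤ (n - 1)(n - 8) < n(n - 8) = 12kn, contrary to Heawood's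
    -- inequality.
    nlinarith [Int.natCast_nonneg (K.faceNumber 0)]
  · rw [ringelComplex_faceNumber_zero, hχ]
    push_cast
    exact (ceil_heawood_ringel hk).symm
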